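/- Let $B_1,B_2,B_3\in\mathbb{R}^{4\times 4}$ be the skew-symmetric matrices $$B_1=\begin{pmatrix}0&0&0&-1\\0&0&1&0\\0&-1&0&0\\1&0&0&0\end{pmatrix},\quad B_2=\begin{pmatrix}0&0&-1&0\\0&0&0&-1\\1&0&0&0\\0&1&0&0\end{pmatrix},\quad B_3=\begin{pmatrix}0&1&0&0\\-1&0&0&0\\0&0&0&-1\\0&0&1&0\end{pmatrix},$$ and let $A_i=\begin{pmatrix}0&B_i\\B_i&0\end{pmatrix}$ for $i=1,2,3$ and $A_4=\begin{pmatrix}0&I\\-I&0\end{pmatrix}$ in $\mathbb{R}^{8\times 8}$. Let $X_i(z)=A_iz$ ($i=1,\dots,4$) be the corresponding tangent vector fields on $\mathbb{S}^7\subset\mathbb{R}^8$, let $\mathcal{H}_T=\mathrm{span}\{X_1,\dots,X_4\}$, and let $\mathbb{S}^7_T$ be $\mathbb{S}^7$ with the distribution $\mathcal{H}_T$ and the restriction to $\mathcal{H}_T$ of the standard Riemannian metric $\langle\cdot,\cdot\rangle$. Let $\mathcal{P}_T$ be the Popp volume of $\mathbb{S}^7_T$, that is, the smooth volume form (unique up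 to sign) taking the value $\pm1$ on $(e_1,\dots,e_4,f_1,f_2,f_3)$ whenever, at a point $q$, $e$ is an orthonormal basis of $\mathcal{H}_{T,q}$ and the classes of $f_1,f_2,f_3$ form an orthonormal basis of $T_q\mathbb{S}^7/\mathcal{H}_{T,q}$ for the inner product that is the quotient of the one on $\mathcal{H}_{T,q}\otimes\mathcal{H}_{T,q}$ under the surjective map $V\otimes W\mapsto[V,W]_q \bmod \mathcal{H}_{T,q}$. The intrinsic sublaplacian of $\mathbb{S}^7_T$ is $$\Delta^T_{\mathrm{sub}}f=-\mathrm{div}_{\mathcal{P}_T}(\nabla_{\mathcal{H}}f),\qquad f\in C^\infty(\mathbb{S}^7),$$ where the horizontal gradient $\nabla_{\mathcal H}f$ is the section of $\mathcal{H}_T$ with $\langle\nabla_{\mathcal H}f,v\rangle=df(v)$ for all $v\in\mathcal{H}_T$, and the divergence is defined by $\mathcal{L}_X\mathcal{P}_T=\mathrm{div}_{\mathcal{P}_T}(X)\,\mathcal{P}_T$. Then the intrinsic sublaplacian of $\mathbb{S}^7_T$ is well defined, and for every $f\in C^\infty(\mathbb{S}^7)$ $$\Delta^T_{\mathrm{sub}}f=-\sum_{i=1}^4\bigl(X_i(X_if)+X_i(h)\,X_if\bigr),\qquad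 h(z)=-\tfrac32\log\bigl(1-2\|x\|^2\|y\|^2\bigr),$$ where $z=(x,y)\in\mathbb{S}^7\subset\mathbb{R}^4\times\mathbb{R}^4$. -/

import Mathlib

open scoped Manifold ContDiff TensorProduct

noncomputable section

namespace SubRiemannian

section General

variable {E : Type*} [NormedAddCommGroup E] [NormedSpace ℝ E]
  {M : Type*} [TopologicalSpace M] [ChartedSpace E M]
  [IsManifold 𝓘(ℝ, E) ∞ M]

/-- The vector field `V` on `M` is smooth near the point `q`. -/
def SmoothFieldAt (V : (p : M) → TangentSpace 𝓘(ℝ, E) p) (q : M) : Prop :=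
  ContMDiffAt 𝓘(ℝ, E) 𝓘(ℝ, E).tangent ∞
    (fun p => (⟨p, V p⟩ : TangentBundle 𝓘(ℝ, E) M)) q

/-- The derivative `X(φ) = dφ(X)` of a function `φ` along a vector field `X`. -/
def fieldDeriv (X : (p : M) → TangentSpace 𝓘(ℝ, E) p) (φ : M → ℝ) : M → ℝ :=
  fun q => mvfderiv 𝓘(ℝ, E) φ q (X q)

/-- A field of alternating forms of top degree on `M`, with arguments indexed by `ι`. -/
abbrev TopForm (E : Type*) [NormedAddCommGroup E] [NormedSpace ℝ E]
    (M : Type*) [TopologicalSpace M] [ChartedSpace E M] (ι : Type*) : Type _ :=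
  (q : M) → (TangentSpace 𝓘(ℝ, E) q) [⋀^ι]→ₗ[ℝ] ℝ

/-- A form is smooth if its value on smooth (local) vector fields is smooth. -/
def TopForm.Smooth {ι : Type*} (ν : TopForm E M ι) : Prop :=
  ∀ (q : M) (Y : ι → (p : M) → TangentSpace 𝓘(ℝ, E) p), (∀ i, SmoothFieldAt (Y i) q) →
    ContMDiffAt 𝓘(ℝ, E) 𝓘(ℝ, ℝ) ∞ (fun p => ν p (fun i => Y i p)) q

/-- The Lie derivative of `ν` along `X`, evaluated on vector fields `Y` at `q`:
`(L_X ν)(Y₁, …, Yₙ) = X(ν(Y₁, …, Yₙ)) - ∑ᵢ ν(Y₁, …, [X, Yᵢ], …, Yₙ)`. -/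
def TopForm.lieDeriv {ι : Type*} [Fintype ι] [DecidableEq ι] (ν : TopForm E M ι)
    (X : (p : M) → TangentSpace 𝓘(ℝ, E) p) (Y : ι → (p : M) → TangentSpace 𝓘(ℝ, E) p)
    (q : M) : ℝ :=
  fieldDeriv X (fun p => ν p (fun i => Y i p)) q -
    ∑ i, ν q (Function.update (fun j => Y j q) i
      (VectorField.mlieBracket 𝓘(ℝ, E) X (Y i) q))

/-- `d` is the divergence of the vector field `X` with respect to the volume form `ν`:
`L_X ν = d ν`. -/
def TopForm.IsDivergence {ι : Type*} [Fintype ι] [DecidableEq ι] (ν : TopForm E M ι)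
    (X : (p : M) → TangentSpace 𝓘(ℝ, E) p) (d : M → ℝ) : Prop :=
  ∀ (q : M) (Y : ι → (p : M) → TangentSpace 𝓘(ℝ, E) p), (∀ i, SmoothFieldAt (Y i) q) →
    ν.lieDeriv X Y q = d q * ν q (fun i => Y i q)

variable (E M) in
/-- A smooth distribution of rank `m` and corank `k` on `M` with a smooth fibre inner product;
smoothness of both is the existence of smooth local orthonormal frames. The bracket generating
condition (of step two) is the surjectivity in `IsLeviMap`, required by `IsPoppVolume`. -/
structure SubRiemannianStructure (m k : ℕ) where
  /-- the distribution -/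
  horizontal : (q : M) → Submodule ℝ (TangentSpace 𝓘(ℝ, E) q)
  /-- the fibre inner product -/
  metric : (q : M) → LinearMap.BilinForm ℝ (horizontal q)
  metric_symm : ∀ q v w, metric q v w = metric q w v
  metric_pos : ∀ q v, v ≠ 0 → 0 < metric q v v
  finrank_eq : Module.finrank ℝ E = m + k
  exists_frame : ∀ q : M, ∃ X : Fin m → (p : M) → horizontal p, ∃ U : Set M, IsOpen U ∧ q ∈ U ∧
    ∀ p ∈ U, (∀ i, SmoothFieldAt (fun p => (X i p : TangentSpace 𝓘(ℝ, E) p)) p) ∧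
      (∀ i j, metric p (X i p) (X j p) = if i = j then 1 else 0) ∧
      Submodule.span ℝ (Set.range fun i => X i p) = ⊤

namespace SubRiemannianStructure

variable {m k : ℕ} (S : SubRiemannianStructure E M m k)

/-- `L : H_q ⊗ H_q → T_q M / H_q` is the surjective linear map `V ⊗ W ↦ [V, W] mod H_q` defined
by the Lie bracket of horizontal vector fields. Surjectivity says that the distribution is bracket
generating of step two at `q` (of step at most two when the corank is zero). -/
def IsLeviMap (q : M)
    (L : (S.horizontal q ⊗[ℝ] S.horizontal q) →ₗ[ℝ]
      (TangentSpace 𝓘(ℝ, E) q ⧸ S.horizontal q)) : Prop :=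
  Function.Surjective L ∧
  ∀ V W : (p : M) → S.horizontal p,
    SmoothFieldAt (fun p => (V p : TangentSpace 𝓘(ℝ, E) p)) q →
    SmoothFieldAt (fun p => (W p : TangentSpace 𝓘(ℝ, E) p)) q →
    L (V q ⊗ₜ[ℝ] W q) = (S.horizontal q).mkQ
      (VectorField.mlieBracket 𝓘(ℝ, E) (fun p => (V p : TangentSpace 𝓘(ℝ, E) p))
        (fun p => (W p : TangentSpace 𝓘(ℝ, E) p)) q)

/-- `n` is the square of the norm of `ζ ∈ T_q M / H_q` in the quotient of the tensor product
inner product on `H_q ⊗ H_q` by the map `L`, that is `n = min {‖ξ‖² : L ξ = ζ}`. -/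
def IsQuotientNormSq (q : M)
    (L : (S.horizontal q ⊗[ℝ] S.horizontal q) →ₗ[ℝ]
      (TangentSpace 𝓘(ℝ, E) q ⧸ S.horizontal q))
    (ζ : TangentSpace 𝓘(ℝ, E) q ⧸ S.horizontal q) (n : ℝ) : Prop :=
  IsLeast {r : ℝ | ∃ ξ, L ξ = ζ ∧ r = (S.metric q).tmul (S.metric q) ξ ξ} n

/-- `ν` is a Popp volume form of the (step two) structure: it is smooth, and at each point it
takes the value `±1` on `(e₁, …, eₘ, f₁, …, fₖ)` where `e` is an orthonormal basis of `H_q` and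
the classes of `f` form an orthonormal basis of `T_q M / H_q`, for the inner product that
`T_q M / H_q` carries as a quotient of `H_q ⊗ H_q` under the Lie bracket. Here "the classes of
`f` are orthonormal" is expressed by `‖∑ cᵢ [fᵢ]‖² = ∑ cᵢ²` for all `c`. The value `±1` does not
depend on the choice of `e` and `f`. On a connected orientable manifold the Popp volume form is
unique up to sign; its absolute value is the Popp measure. -/
def IsPoppVolume (ν : TopForm E M (Fin m ⊕ Fin k)) : Prop :=
  ν.Smooth ∧
  ∀ q : M, ∃ L, S.IsLeviMap q L ∧
    ∃ (e : Fin m → S.horizontal q) (f : Fin k → TangentSpace 𝓘(ℝ, E) q),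
      (∀ i j, S.metric q (e i) (e j) = if i = j then 1 else 0) ∧
      (∀ c : Fin k → ℝ,
        S.IsQuotientNormSq q L (∑ i, c i • (S.horizontal q).mkQ (f i)) (∑ i, c i ^ 2)) ∧
      |ν q (Sum.elim (fun i => (e i : TangentSpace 𝓘(ℝ, E) q)) f)| = 1

/-- `G` is the horizontal gradient of `f`: `G` is horizontal and `⟨G, v⟩ = df(v)` for all
horizontal `v`. -/
def IsHorizontalGradient (f : M → ℝ) (G : (p : M) → S.horizontal p) : Prop :=
  ∀ (q : M) (v : S.horizontal q),
    S.metric q (G q) v = mvfderiv 𝓘(ℝ, E) f q (v : TangentSpace 𝓘(ℝ, E) q)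

/-- `u = Δ f` for the intrinsic sublaplacian `Δ f = -div_P (∇_H f)`, where `P` is the Popp
volume (the divergence is not affected by the sign of the volume form). -/
def IsIntrinsicSublaplacian (f : C^∞⟮𝓘(ℝ, E), M; 𝓘(ℝ, ℝ), ℝ⟯) (u : M → ℝ) : Prop :=
  ∃ (ν : TopForm E M (Fin m ⊕ Fin k)) (G : (p : M) → S.horizontal p),
    S.IsPoppVolume ν ∧ S.IsHorizontalGradient f G ∧
      ν.IsDivergence (fun p => (G p : TangentSpace 𝓘(ℝ, E) p)) (fun q => -u q)

end SubRiemannianStructure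

end General

/-! The trivializable structure on the seven-sphere. -/

/-- The seven-sphere in `ℝ⁸`. -/
abbrev S7 : Type := Metric.sphere (0 : EuclideanSpace ℝ (Fin 8)) 1

instance factFinrank : Fact (Module.finrank ℝ (EuclideanSpace ℝ (Fin 8)) = 7 + 1) :=
  ⟨finrank_euclideanSpace_fin⟩

/-- The differential of the inclusion of the sphere in `ℝ⁸`. -/
abbrev dIncl (z : S7) : TangentSpace (𝓡 7) z →L[ℝ] EuclideanSpace ℝ (Fin 8) :=
  mvfderiv (𝓡 7) ((↑) : S7 → EuclideanSpace ℝ (Fin 8)) z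

/-- The skew-symmetric `4 × 4` matrices `B₁, B₂, B₃`. -/
def matB : Fin 3 → Matrix (Fin 4) (Fin 4) ℝ :=
  ![!![0, 0, 0, -1; 0, 0, 1, 0; 0, -1, 0, 0; 1, 0, 0, 0],
    !![0, 0, -1, 0; 0, 0, 0, -1; 1, 0, 0, 0; 0, 1, 0, 0],
    !![0, 1, 0, 0; -1, 0, 0, 0; 0, 0, 0, -1; 0, 0, 1, 0]]

/-- The anti-commuting skew-symmetric `8 × 8` matrices with blocks
`A₁, A₂, A₃ = (0, Bᵢ; Bᵢ, 0)` and `A₄ = (0, 1; -1, 0)`. -/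
def matA : Fin 4 → Matrix (Fin 8) (Fin 8) ℝ :=
  fun i => Matrix.reindex finSumFinEquiv finSumFinEquiv
    (![Matrix.fromBlocks 0 (matB 0) (matB 0) 0,
       Matrix.fromBlocks 0 (matB 1) (matB 1) 0,
       Matrix.fromBlocks 0 (matB 2) (matB 2) 0,
       Matrix.fromBlocks 0 1 (-1) 0] i)

/-- The linear map `z ↦ A z` of `ℝ⁸`. -/
def mulA (i : Fin 4) : EuclideanSpace ℝ (Fin 8) →L[ℝ] EuclideanSpace ℝ (Fin 8) :=
  Matrix.toEuclideanCLM (𝕜 := ℝ) (matA i)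

lemma mulA_coords (z : EuclideanSpace ℝ (Fin 8)) :
    mulA 0 z = !₂[-z 7, z 6, -z 5, z 4, -z 3, z 2, -z 1, z 0] ∧
    mulA 1 z = !₂[-z 6, -z 7, z 4, z 5, -z 2, -z 3, z 0, z 1] ∧
    mulA 2 z = !₂[z 5, -z 4, -z 7, z 6, z 1, -z 0, -z 3, z 2] ∧
    mulA 3 z = !₂[z 4, z 5, z 6, z 7, -z 0, -z 1, -z 2, -z 3] := by
  have e0 : finSumFinEquiv.symm (0 : Fin (4 + 4)) = Sum.inl 0 := rfl
  have e1 : finSumFinEquiv.symm (1 : Fin (4 + 4)) = Sum.inl 1 := rfl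
  have e2 : finSumFinEquiv.symm (2 : Fin (4 + 4)) = Sum.inl 2 := rfl
  have e3 : finSumFinEquiv.symm (3 : Fin (4 + 4)) = Sum.inl 3 := rfl
  have e4 : finSumFinEquiv.symm (4 : Fin (4 + 4)) = Sum.inr 0 := rfl
  have e5 : finSumFinEquiv.symm (5 : Fin (4 + 4)) = Sum.inr 1 := rfl
  have e6 : finSumFinEquiv.symm (6 : Fin (4 + 4)) = Sum.inr 2 := rfl
  have e7 : finSumFinEquiv.symm (7 : Fin (4 + 4)) = Sum.inr 3 := rfl
  have key (i : Fin 4) (a : Fin 8) :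
      mulA i z a = ∑ b : Fin 8, matA i a b * z b := rfl
  refine ⟨?_, ?_, ?_, ?_⟩ <;> ext a <;> rw [key] <;> fin_cases a <;>
    simp [Fin.sum_univ_eight, matA, matB, e0, e1, e2, e3, e4, e5, e6, e7]

lemma inner_mulA_self (i : Fin 4) (z : EuclideanSpace ℝ (Fin 8)) :
    inner ℝ z (mulA i z) = 0 := by
  obtain ⟨h0, h1, h2, h3⟩ := mulA_coords z
  fin_cases i <;>
    simp only [Fin.zero_eta, Fin.mk_one, Fin.reduceFinMk, h0, h1, h2, h3, PiLp.inner_apply,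
      Fin.sum_univ_eight] <;> simp <;> ring

lemma inner_mulA_mulA (i j : Fin 4) (z : EuclideanSpace ℝ (Fin 8)) :
    inner ℝ (mulA i z) (mulA j z) = if i = j then ‖z‖ ^ 2 else 0 := by
  obtain ⟨h0, h1, h2, h3⟩ := mulA_coords z
  rw [EuclideanSpace.real_norm_sq_eq]
  fin_cases i <;> fin_cases j <;>
    simp only [Fin.zero_eta, Fin.mk_one, Fin.reduceFinMk, h0, h1, h2, h3, PiLp.inner_apply,
      Fin.sum_univ_eight] <;> simp <;> ring

lemma mulA_mem_range (i : Fin 4) (z : S7) :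
    mulA i z ∈ (dIncl z).toLinearMap.range := by
  have h : (dIncl z).toLinearMap.range = _ := range_mvfderiv_subtypeVal z
  rw [h, Submodule.mem_orthogonal_singleton_iff_inner_right]
  exact inner_mulA_self i z

/-- The canonical vector field `X_{i+1} = X(A_{i+1})` on the sphere: the tangent vector
`X(z)` is the one whose image in `ℝ⁸` is `A z`. -/
def fieldX (i : Fin 4) (z : S7) : TangentSpace (𝓡 7) z :=
  (LinearEquiv.ofInjective (dIncl z).toLinearMap (injective_mvfderiv_subtypeVal_sphere z)).symm
    ⟨mulA i z, mulA_mem_range i z⟩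

lemma dIncl_fieldX (i : Fin 4) (z : S7) : dIncl z (fieldX i z) = mulA i z := by
  have h := (LinearEquiv.ofInjective (dIncl z).toLinearMap
    (injective_mvfderiv_subtypeVal_sphere z)).apply_symm_apply ⟨mulA i z, mulA_mem_range i z⟩
  exact congrArg Subtype.val h

/-- The integral curves `(t, z) ↦ cos t z + sin t A z` of the canonical vector fields. -/
def flowX (i : Fin 4) : ℝ × S7 → S7 :=
  Set.codRestrict (fun p => Real.cos p.1 • (p.2 : EuclideanSpace ℝ (Fin 8)) +
    Real.sin p.1 • mulA i p.2) _ (fun p => by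
      have h : ‖(p.2 : EuclideanSpace ℝ (Fin 8))‖ = 1 := norm_eq_of_mem_sphere p.2
      have h2 := inner_mulA_mulA i i (p.2 : EuclideanSpace ℝ (Fin 8))
      rw [mem_sphere_zero_iff_norm, ← sq_eq_sq₀ (norm_nonneg _) zero_le_one,
        ← real_inner_self_eq_norm_sq]
      simp only [inner_add_left, inner_add_right, inner_smul_left, inner_smul_right,
        inner_mulA_self, real_inner_comm (p.2 : EuclideanSpace ℝ (Fin 8)) (mulA i p.2), h2,
        real_inner_self_eq_norm_sq, h]
      simp
      nlinarith [Real.sin_sq_add_cos_sq p.1])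

lemma flowX_smooth (i : Fin 4) : ContMDiff (𝓘(ℝ, ℝ).prod (𝓡 7)) (𝓡 7) ∞ (flowX i) := by
  refine ContMDiff.codRestrict_sphere ?_ _
  have h2 : ContMDiff (𝓘(ℝ, ℝ).prod (𝓡 7)) 𝓘(ℝ, EuclideanSpace ℝ (Fin 8)) ∞
      (fun p : ℝ × S7 => (p.2 : EuclideanSpace ℝ (Fin 8))) :=
    contMDiff_coe_sphere.comp contMDiff_snd
  have hc : ContMDiff (𝓘(ℝ, ℝ).prod (𝓡 7)) 𝓘(ℝ, ℝ) ∞ (fun p : ℝ × S7 => Real.cos p.1) :=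
    Real.contDiff_cos.contMDiff.comp contMDiff_fst
  have hs : ContMDiff (𝓘(ℝ, ℝ).prod (𝓡 7)) 𝓘(ℝ, ℝ) ∞ (fun p : ℝ × S7 => Real.sin p.1) :=
    Real.contDiff_sin.contMDiff.comp contMDiff_fst
  exact (hc.smul h2).add (hs.smul ((mulA i).contDiff.contMDiff.comp h2))

lemma dIncl_mfderiv_flowX (i : Fin 4) (z : S7) :
    dIncl (flowX i (0, z)) (mfderiv (𝓘(ℝ, ℝ).prod (𝓡 7)) (𝓡 7) (flowX i) (0, z)
      ((1, 0) : ℝ × EuclideanSpace ℝ (Fin 7))) = mulA i z := by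
  have hF : MDifferentiableAt (𝓘(ℝ, ℝ).prod (𝓡 7)) (𝓡 7) (flowX i) (0, z) :=
    (flowX_smooth i).mdifferentiableAt (by simp)
  have hι : MDifferentiableAt (𝓡 7) 𝓘(ℝ, EuclideanSpace ℝ (Fin 8))
      ((↑) : S7 → EuclideanSpace ℝ (Fin 8)) (flowX i (0, z)) :=
    (contMDiff_coe_sphere (m := 1)).mdifferentiableAt one_ne_zero
  have hc : HasMFDerivAt 𝓘(ℝ, ℝ) (𝓘(ℝ, ℝ).prod (𝓡 7)) (fun t : ℝ => (t, z)) 0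
      (ContinuousLinearMap.inl ℝ ℝ (EuclideanSpace ℝ (Fin 7))) := by
    have h : MDifferentiableAt 𝓘(ℝ, ℝ) (𝓘(ℝ, ℝ).prod (𝓡 7)) (fun t : ℝ => (t, z)) 0 :=
      mdifferentiableAt_id.prodMk mdifferentiableAt_const
    have h2 := h.hasMFDerivAt
    rw [mfderiv_prod_left] at h2
    exact h2
  have h1 := (hι.hasMFDerivAt.comp (0, z) hF.hasMFDerivAt).comp (0 : ℝ) hc
  have h2 : HasDerivAt (fun t : ℝ => Real.cos t • (z : EuclideanSpace ℝ (Fin 8)) +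
      Real.sin t • mulA i z) (mulA i z) 0 := by
    have := ((Real.hasDerivAt_cos 0).smul_const (z : EuclideanSpace ℝ (Fin 8))).fun_add
      ((Real.hasDerivAt_sin 0).smul_const (mulA i z))
    simpa using this
  have h3 := hasMFDerivAt_unique h1 h2.hasFDerivAt.hasMFDerivAt
  have h4 := congrArg (fun L : ℝ →L[ℝ] EuclideanSpace ℝ (Fin 8) => L 1) h3
  refine Eq.trans ?_ (h4.trans ?_)
  · rfl
  · exact one_smul ℝ _

lemma fieldX_smooth (i : Fin 4) (z : S7) : SmoothFieldAt (fieldX i) z := by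
  have hv (z w : S7) (hw : w = z) (v : TangentSpace (𝓡 7) w) (h : dIncl w v = mulA i z) :
      (⟨z, fieldX i z⟩ : TangentBundle (𝓡 7) S7) = ⟨w, v⟩ := by
    subst hw
    rw [injective_mvfderiv_subtypeVal_sphere w ((dIncl_fieldX i w).trans h.symm)]
  have h0 (z : S7) : flowX i (0, z) = z := Subtype.ext (by simp [flowX])
  have h1 : ContMDiff (𝓡 7) ((𝓘(ℝ, ℝ).tangent).prod (𝓡 7).tangent) ∞ (fun z : S7 =>
      ((⟨0, 1⟩ : TangentBundle 𝓘(ℝ, ℝ) ℝ), (⟨z, 0⟩ : TangentBundle (𝓡 7) S7))) :=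
    contMDiff_const.prodMk
      (Bundle.contMDiff_zeroSection ℝ (TangentSpace (𝓡 7) : S7 → Type _))
  have h2 := ((flowX_smooth i).contMDiff_tangentMap (m := ∞) (by simp)).comp
    ((contMDiff_equivTangentBundleProd_symm (I := 𝓘(ℝ, ℝ)) (I' := 𝓡 7) (M := ℝ) (M' := S7)
      (n := ∞)).comp h1)
  refine ContMDiffAt.congr_of_eventuallyEq (h2 z) (Filter.Eventually.of_forall fun p => ?_)
  exact hv p _ (h0 p) _ (dIncl_mfderiv_flowX i p)

/-- The distribution spanned by the four canonical vector fields. -/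
def horizontalT (z : S7) : Submodule ℝ (TangentSpace (𝓡 7) z) :=
  Submodule.span ℝ (Set.range fun i => fieldX i z)

/-- The trivializable subriemannian structure on the seven-sphere, with the restriction of the
standard Riemannian metric. -/
def S7T : SubRiemannianStructure (EuclideanSpace ℝ (Fin 7)) S7 4 3 where
  horizontal := horizontalT
  metric z := (innerₗ (EuclideanSpace ℝ (Fin 8))).compl₁₂
    ((dIncl z).toLinearMap ∘ₗ (horizontalT z).subtype)
    ((dIncl z).toLinearMap ∘ₗ (horizontalT z).subtype)
  metric_symm z v w := by
    simpa using real_inner_comm _ _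
  metric_pos z v hv := by
    have h : dIncl z (v : TangentSpace (𝓡 7) z) ≠ 0 := fun h0 =>
      hv (Subtype.ext (injective_mvfderiv_subtypeVal_sphere z (h0.trans (map_zero _).symm)))
    simpa using real_inner_self_pos.mpr h
  finrank_eq := by simp
  exists_frame q := by
    refine ⟨fun i p => ⟨fieldX i p, Submodule.subset_span ⟨i, rfl⟩⟩, Set.univ, isOpen_univ,
      trivial, fun p _ => ⟨fun i => fieldX_smooth i p, fun i j => ?_, ?_⟩⟩
    · have h : ‖(p : EuclideanSpace ℝ (Fin 8))‖ = 1 := norm_eq_of_mem_sphere p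
      simpa [dIncl_fieldX, h] using inner_mulA_mulA i j (p : EuclideanSpace ℝ (Fin 8))
    · refine Eq.trans ?_ (Submodule.span_span_coe_preimage
        (R := ℝ) (s := Set.range fun i => fieldX i p))
      congr 1
      ext v
      simp only [Set.mem_range, Subtype.ext_iff]
      exact Iff.rfl

/-- The function `h(z) = -(3/2) log (1 - 2 ‖x‖² ‖y‖²)` for `z = (x, y) ∈ ℝ⁴ × ℝ⁴`. -/
def weightH (z : S7) : ℝ :=
  -(3 / 2) * Real.log (1 - 2 * (∑ i : Fin 4, (z : EuclideanSpace ℝ (Fin 8)) (Fin.castAdd 4 i) ^ 2)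
    * (∑ i : Fin 4, (z : EuclideanSpace ℝ (Fin 8)) (Fin.natAdd 4 i) ^ 2))

end SubRiemannian

end

open scoped Manifold ContDiff TensorProduct

noncomputable section

namespace SubRiemannian

/-! ### Differential calculus of vector-valued functions on a manifold -/

section Calculus

variable {E : Type*} [NormedAddCommGroup E] [NormedSpace ℝ E]
  {M : Type*} [TopologicalSpace M] [ChartedSpace E M]
  {F : Type*} [NormedAddCommGroup F] [NormedSpace ℝ F]

/-! The sphere carries a global orthonormal frame of linear vector fields: the four `mulA i z`
spanning the distribution and three `normalMap k z` spanning its orthogonal complement. If `V`, `W`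
are horizontal, differentiating `⟨N_k z, V⟩ = 0` and `⟨N_k z, W⟩ = 0` shows that the `N_k`-component
of `[V, W]` is `2⟨V, N_k W⟩`. The Levi map is therefore explicit and algebraic (`leviMap`).

The three 4 × 4 coefficient arrays of this map are mutually orthogonal, all of squared norm
`leviScale = 16(‖x‖⁴ + ‖y‖⁴)` (`sum_inner_frameMap_normalMap`). A least-norm argument then gives the
quotient inner product: the classes of the `N_k` are orthogonal of squared norm `1 / leviScale`.
Hence the value `w` of a Popp form on the frame satisfies `w² * leviScale³ = 1`
(`IsPoppVolume.sq_mul`). On the unit sphere `‖x‖⁴ + ‖y‖⁴ = 1 - 2‖x‖²‖y‖²`, so `log |w|` differs from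
`h` by a constant.

Finally, `L_X ν = (X w / w + frameDiv X) ν` (`lieDeriv_eq`), where `X w / w = X h`. Every frame
field has great circles as integral curves, so `frameDiv X` is the sum of the derivatives of the
frame coefficients of `X` along the frame; for the horizontal gradient it is `∑ X_i X_i f`. The
computation applies to every Popp form and every gradient, which gives uniqueness; `poppForm` and an
explicit gradient give existence. -/

lemma mvfderiv_congr {φ ψ : M → F} {q : M} (h : φ =ᶠ[nhds q] ψ) :
    mvfderiv 𝓘(ℝ, E) φ q = mvfderiv 𝓘(ℝ, E) ψ q := by
  ext v
  have := congrArg (fun L : TangentSpace 𝓘(ℝ, E) q →L[ℝ] F => L v)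
    (show (mfderiv 𝓘(ℝ, E) 𝓘(ℝ, F) φ q : E →L[ℝ] F) = mfderiv 𝓘(ℝ, E) 𝓘(ℝ, F) ψ q from
      h.mfderiv_eq)
  exact this

lemma mvfderiv_comp_fderiv {F' : Type*} [NormedAddCommGroup F'] [NormedSpace ℝ F']
    {g : F → F'} {φ : M → F} {q : M} (hg : DifferentiableAt ℝ g (φ q))
    (hφ : MDifferentiableAt 𝓘(ℝ, E) 𝓘(ℝ, F) φ q) (v : TangentSpace 𝓘(ℝ, E) q) :
    mvfderiv 𝓘(ℝ, E) (fun p => g (φ p)) q v =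
      fderiv ℝ g (φ q) (mvfderiv 𝓘(ℝ, E) φ q v) := by
  have h := hg.hasFDerivAt.hasMFDerivAt.comp q hφ.hasMFDerivAt
  have h2 := h.mfderiv
  exact congrArg (fun L : E →L[ℝ] F' => L v) h2

lemma mvfderiv_inner {F : Type*} [NormedAddCommGroup F] [InnerProductSpace ℝ F]
    {φ ψ : M → F} {q : M} (hφ : MDifferentiableAt 𝓘(ℝ, E) 𝓘(ℝ, F) φ q)
    (hψ : MDifferentiableAt 𝓘(ℝ, E) 𝓘(ℝ, F) ψ q) (v : TangentSpace 𝓘(ℝ, E) q) :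
    mvfderiv 𝓘(ℝ, E) (fun p => inner ℝ (φ p) (ψ p)) q v =
      inner ℝ (φ q) (mvfderiv 𝓘(ℝ, E) ψ q v) + inner ℝ (mvfderiv 𝓘(ℝ, E) φ q v) (ψ q) := by
  have h := (hφ.prodMk_space hψ)
  have h2 := mvfderiv_comp_fderiv (E := E) (g := fun p : F × F => inner ℝ p.1 p.2)
    (φ := fun p => (φ p, ψ p)) (q := q) (differentiableAt_fst.inner ℝ differentiableAt_snd) h v
  rw [h2, fderiv_inner_apply ℝ differentiableAt_fst differentiableAt_snd, fderiv_fst, fderiv_snd]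
  have h3 := mvfderiv_comp_fderiv (E := E) (g := (Prod.fst : F × F → F)) differentiableAt_fst h v
  have h4 := mvfderiv_comp_fderiv (E := E) (g := (Prod.snd : F × F → F)) differentiableAt_snd h v
  rw [fderiv_fst] at h3
  rw [fderiv_snd] at h4
  rw [← h3, ← h4]

variable [IsManifold 𝓘(ℝ, E) ∞ M]

lemma SmoothFieldAt.mdifferentiableAt {V : (p : M) → TangentSpace 𝓘(ℝ, E) p} {q : M}
    (hV : SmoothFieldAt V q) :
    MDifferentiableAt 𝓘(ℝ, E) 𝓘(ℝ, E).tangent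
      (fun p => (⟨p, V p⟩ : TangentBundle 𝓘(ℝ, E) M)) q :=
  ContMDiffAt.mdifferentiableAt hV (by simp)

lemma SmoothFieldAt.contMDiffAt_mvfderiv {V : (p : M) → TangentSpace 𝓘(ℝ, E) p} {q : M}
    (hV : SmoothFieldAt V q) {φ : M → F} (hφ : ContMDiff 𝓘(ℝ, E) 𝓘(ℝ, F) ∞ φ) :
    ContMDiffAt 𝓘(ℝ, E) 𝓘(ℝ, F) ∞ (fun p => mvfderiv 𝓘(ℝ, E) φ p (V p)) q := by
  have h1 : ContMDiff 𝓘(ℝ, E).tangent 𝓘(ℝ, F).tangent ∞ (tangentMap 𝓘(ℝ, E) 𝓘(ℝ, F) φ) :=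
    hφ.contMDiff_tangentMap (by simp)
  have h2 := (contMDiff_snd_tangentBundle_modelSpace (n := ∞) F 𝓘(ℝ, F)).contMDiffAt.comp q
    ((h1 _).comp q hV)
  exact h2

/-- Both sides are read in the chart at `q`, where the identity is the symmetry of the second
derivative. With `φ` the inclusion of the sphere, brackets on the sphere become computations in
`ℝ⁸`. -/
lemma mvfderiv_mlieBracket [CompleteSpace E] {V W : (p : M) → TangentSpace 𝓘(ℝ, E) p} {q : M}
    (hV : SmoothFieldAt V q) (hW : SmoothFieldAt W q) {φ : M → F}
    (hφ : ContMDiff 𝓘(ℝ, E) 𝓘(ℝ, F) ∞ φ) :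
    mvfderiv 𝓘(ℝ, E) φ q (VectorField.mlieBracket 𝓘(ℝ, E) V W q) =
      mvfderiv 𝓘(ℝ, E) (fun p => mvfderiv 𝓘(ℝ, E) φ p (W p)) q (V q) -
        mvfderiv 𝓘(ℝ, E) (fun p => mvfderiv 𝓘(ℝ, E) φ p (V p)) q (W q) := by
  have : IsManifold 𝓘(ℝ, E) 2 M := IsManifold.of_le (n := ∞) (by norm_cast)
  set c := extChartAt 𝓘(ℝ, E) q with hc
  have htgt := extChartAt_target_mem_nhds (I := 𝓘(ℝ, E)) q
  have hcq : c.symm (c q) = q := extChartAt_to_inv q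
  -- `P V` is the field `V` expressed in the chart `c`.
  let P (V : (p : M) → TangentSpace 𝓘(ℝ, E) p) : E → E := fun y =>
    VectorField.mpullbackWithin 𝓘(ℝ, E) 𝓘(ℝ, E) c.symm V (Set.range 𝓘(ℝ, E)) y
  -- the derivative of a function at `q` in the chart
  have key : ∀ (ψ : M → F), ∀ y ∈ c.target,
      MDifferentiableAt 𝓘(ℝ, E) 𝓘(ℝ, F) ψ (c.symm y) → ∀ V : (p : M) → TangentSpace 𝓘(ℝ, E) p,
      fderiv ℝ (ψ ∘ c.symm) y
        (P V y) =
      mvfderiv 𝓘(ℝ, E) ψ (c.symm y) (V (c.symm y)) := by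
    intro ψ y hy hψ V
    have h1 : MDifferentiableAt 𝓘(ℝ, E) 𝓘(ℝ, E) c.symm y := by
      have := mdifferentiableWithinAt_extChartAt_symm (I := 𝓘(ℝ, E)) hy
      rwa [modelWithCornersSelf_coe, Set.range_id, mdifferentiableWithinAt_univ] at this
    have h2 := mfderiv_comp y hψ h1
    rw [← mfderiv_eq_fderiv, h2]
    have h3 := isInvertible_mfderivWithin_extChartAt_symm (I := 𝓘(ℝ, E)) hy
    have h4 : mfderiv 𝓘(ℝ, E) 𝓘(ℝ, E) c.symm y
        ((mfderiv 𝓘(ℝ, E) 𝓘(ℝ, E) c.symm y).inverse (V (c.symm y))) = V (c.symm y) := by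
      have h3' : (mfderiv 𝓘(ℝ, E) 𝓘(ℝ, E) c.symm y).IsInvertible := by
        rwa [modelWithCornersSelf_coe, Set.range_id, mfderivWithin_univ] at h3
      exact h3'.self_apply_inverse _
    have h5 : P V y =
        (mfderiv 𝓘(ℝ, E) 𝓘(ℝ, E) c.symm y).inverse (V (c.symm y)) := by
      simp only [P]
      rw [VectorField.mpullbackWithin_apply, modelWithCornersSelf_coe, Set.range_id, mfderivWithin_univ]
    rw [h5]
    change mfderiv 𝓘(ℝ, E) 𝓘(ℝ, F) ψ (c.symm y) (mfderiv 𝓘(ℝ, E) 𝓘(ℝ, E) c.symm y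
        ((mfderiv 𝓘(ℝ, E) 𝓘(ℝ, E) c.symm y).inverse (V (c.symm y)))) = _
    rw [h4]
    rfl
  have hmd (p : M) : MDifferentiableAt 𝓘(ℝ, E) 𝓘(ℝ, F) φ p := hφ.mdifferentiableAt (by simp)
  have hbr : VectorField.mlieBracket 𝓘(ℝ, E) V W q =
      (mfderiv 𝓘(ℝ, E) 𝓘(ℝ, E) c q).inverse
        (VectorField.lieBracket (E := E) ℝ (P V) (P W) (c q) : E) := by
    rw [← VectorField.mlieBracketWithin_univ, VectorField.mlieBracketWithin_apply]
    congr 1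
    rw [Set.preimage_univ, Set.univ_inter]
    change VectorField.lieBracketWithin (E := E) ℝ (P V) (P W) (Set.range 𝓘(ℝ, E)) (c q) = _
    rw [modelWithCornersSelf_coe, Set.range_id, VectorField.lieBracketWithin_univ]
  have hdiff {V : (p : M) → TangentSpace 𝓘(ℝ, E) p} (hV : SmoothFieldAt V q) :
      DifferentiableAt ℝ
        (P V) (c q) := by
    have := (hV.mdifferentiableAt.mdifferentiableWithinAt
      (s := Set.univ)).differentiableWithinAt_mpullbackWithin_vectorField
    rw [Set.preimage_univ, Set.univ_inter] at this
    simp only [P, modelWithCornersSelf_coe, Set.range_id] at this ⊢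
    exact differentiableWithinAt_univ.1 this
  have hψ : ContDiffAt ℝ ∞ (φ ∘ c.symm) (c q) := by
    have h1 := contMDiffWithinAt_extChartAt_symm_range (n := ∞) (I := 𝓘(ℝ, E)) q
      (mem_extChartAt_target q)
    rw [modelWithCornersSelf_coe, Set.range_id, contMDiffWithinAt_univ] at h1
    exact (hφ.contMDiffAt.comp (c q) h1).contDiffAt
  have hdd {V W : (p : M) → TangentSpace 𝓘(ℝ, E) p} (hW : SmoothFieldAt W q) :
      fderiv ℝ (fun y => fderiv ℝ (φ ∘ c.symm) y
        (P W y)) (c q)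
        (P V (c q)) =
      mvfderiv 𝓘(ℝ, E) (fun p => mvfderiv 𝓘(ℝ, E) φ p (W p)) q (V q) := by
    have h1 : (fun y => fderiv ℝ (φ ∘ c.symm) y
        (P W y))
        =ᶠ[nhds (c q)] (fun p => mvfderiv 𝓘(ℝ, E) φ p (W p)) ∘ c.symm := by
      filter_upwards [htgt] with y hy
      exact key φ y hy (hmd _) W
    rw [h1.fderiv_eq, key _ _ (mem_extChartAt_target q), hcq]
    rw [hcq]
    exact (hW.contMDiffAt_mvfderiv hφ).mdifferentiableAt (by simp)
  have hbr2 : mvfderiv 𝓘(ℝ, E) φ q (VectorField.mlieBracket 𝓘(ℝ, E) V W q) =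
      fderiv ℝ (φ ∘ c.symm) (c q) (VectorField.lieBracket ℝ
        (P V)
        (P W) (c q)) := by
    rw [hbr]
    generalize VectorField.lieBracket ℝ (P V) (P W) (c q) = b
    have hc1 : MDifferentiableAt 𝓘(ℝ, E) 𝓘(ℝ, E) c q :=
      mdifferentiableAt_extChartAt (mem_chart_source E q)
    have h1 : φ =ᶠ[nhds q] fun p => (φ ∘ c.symm) (c p) := by
      filter_upwards [extChartAt_source_mem_nhds (I := 𝓘(ℝ, E)) q] with p hp
      simp only [Function.comp]
      rw [(extChartAt 𝓘(ℝ, E) q).left_inv hp]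
    rw [mvfderiv_congr h1, mvfderiv_comp_fderiv (hψ.differentiableAt (by simp)) hc1]
    congr 1
    exact (isInvertible_mfderiv_extChartAt (I := 𝓘(ℝ, E))
      (mem_extChartAt_source q)).self_apply_inverse b
  rw [hbr2, VectorField.fderiv_apply_lieBracket hψ (by simp [minSmoothness_of_isRCLikeNormedField]; norm_cast) (hdiff hW) (hdiff hV), hdd hW, hdd hV]

end Calculus

/-! ### The global orthonormal frame adapted to the distribution -/

section Frame

/-- The maps `(x, y) ↦ (-R x, R y)` of `ℝ⁸`, where `R` commutes with the matrices `B₁, B₂, B₃`. -/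
def normalFun : Fin 3 → EuclideanSpace ℝ (Fin 8) → EuclideanSpace ℝ (Fin 8) :=
  ![fun z => !₂[-z 3, -z 2, z 1, z 0, z 7, z 6, -z 5, -z 4],
    fun z => !₂[-z 2, z 3, z 0, -z 1, z 6, -z 7, -z 4, z 5],
    fun z => !₂[-z 1, z 0, -z 3, z 2, z 5, -z 4, z 7, -z 6]]

/-- The maps `normalFun` as continuous linear maps. -/
def normalMap (k : Fin 3) : EuclideanSpace ℝ (Fin 8) →L[ℝ] EuclideanSpace ℝ (Fin 8) :=
  LinearMap.toContinuousLinearMap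
    { toFun := normalFun k
      map_add' := fun v w => by
        fin_cases k <;> ext a <;> fin_cases a <;> simp [normalFun] <;> ring
      map_smul' := fun c v => by
        fin_cases k <;> ext a <;> fin_cases a <;> simp [normalFun] }

lemma normalMap_coords (z : EuclideanSpace ℝ (Fin 8)) :
    normalMap 0 z = !₂[-z 3, -z 2, z 1, z 0, z 7, z 6, -z 5, -z 4] ∧
    normalMap 1 z = !₂[-z 2, z 3, z 0, -z 1, z 6, -z 7, -z 4, z 5] ∧
    normalMap 2 z = !₂[-z 1, z 0, -z 3, z 2, z 5, -z 4, z 7, -z 6] :=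
  ⟨rfl, rfl, rfl⟩

/-- The linear maps of `ℝ⁸` that define an orthonormal frame of the sphere adapted to the
distribution. -/
def frameMap : Fin 4 ⊕ Fin 3 → EuclideanSpace ℝ (Fin 8) →L[ℝ] EuclideanSpace ℝ (Fin 8) :=
  Sum.elim mulA normalMap

lemma inner_normalMap_self (k : Fin 3) (z : EuclideanSpace ℝ (Fin 8)) :
    inner ℝ z (normalMap k z) = 0 := by
  obtain ⟨h0, h1, h2⟩ := normalMap_coords z
  fin_cases k <;>
    simp only [Fin.zero_eta, Fin.mk_one, Fin.reduceFinMk, h0, h1, h2, PiLp.inner_apply,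
      Fin.sum_univ_eight] <;> simp <;> ring

lemma inner_normalMap_normalMap (k l : Fin 3) (z : EuclideanSpace ℝ (Fin 8)) :
    inner ℝ (normalMap k z) (normalMap l z) = if k = l then ‖z‖ ^ 2 else 0 := by
  obtain ⟨h0, h1, h2⟩ := normalMap_coords z
  rw [EuclideanSpace.real_norm_sq_eq]
  fin_cases k <;> fin_cases l <;>
    simp only [Fin.zero_eta, Fin.mk_one, Fin.reduceFinMk, h0, h1, h2, PiLp.inner_apply,
      Fin.sum_univ_eight] <;> simp <;> ring

lemma inner_mulA_normalMap (i : Fin 4) (k : Fin 3) (z : EuclideanSpace ℝ (Fin 8)) :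
    inner ℝ (mulA i z) (normalMap k z) = 0 := by
  obtain ⟨h0, h1, h2⟩ := normalMap_coords z
  obtain ⟨g0, g1, g2, g3⟩ := mulA_coords z
  fin_cases i <;> fin_cases k <;>
    simp only [Fin.zero_eta, Fin.mk_one, Fin.reduceFinMk, h0, h1, h2, g0, g1, g2, g3,
      PiLp.inner_apply, Fin.sum_univ_eight] <;> simp <;> ring

lemma inner_frameMap_self (i : Fin 4 ⊕ Fin 3) (z : EuclideanSpace ℝ (Fin 8)) :
    inner ℝ z (frameMap i z) = 0 := by
  rcases i with i | k
  · exact inner_mulA_self i z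
  · exact inner_normalMap_self k z

/-- The seven maps are skew-symmetric and orthogonal and they anticommute pairwise: `ℝ⁸` is a
Clifford module, which parallelizes the sphere. -/
lemma inner_frameMap_frameMap (i j : Fin 4 ⊕ Fin 3) (z : EuclideanSpace ℝ (Fin 8)) :
    inner ℝ (frameMap i z) (frameMap j z) = if i = j then ‖z‖ ^ 2 else 0 := by
  rcases i with i | k <;> rcases j with j | l
  · simpa [frameMap] using inner_mulA_mulA i j z
  · simpa [frameMap] using inner_mulA_normalMap i l z
  · simpa [frameMap, real_inner_comm] using inner_mulA_normalMap j k z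
  · simpa [frameMap] using inner_normalMap_normalMap k l z

/-- Polarization of `⟨z, frameMap i z⟩ = 0`. -/
lemma inner_frameMap_eq_neg (i : Fin 4 ⊕ Fin 3) (v w : EuclideanSpace ℝ (Fin 8)) :
    inner ℝ (frameMap i v) w = -inner ℝ v (frameMap i w) := by
  have h := inner_frameMap_self i (v + w)
  simp only [map_add, inner_add_left, inner_add_right, inner_frameMap_self] at h
  rw [real_inner_comm]
  linarith

set_option maxHeartbeats 2000000 in
-- The decisive computation, a polynomial identity of degree four in `z`, checked by expansion. The
-- constant can be seen at `z = (x, 0)` with `‖x‖ = 1`: the vectors `mulA i z` span `0 × ℝ⁴`, on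
-- which each `normalMap k` is orthogonal with squared Hilbert–Schmidt norm 4, and the factor `2²`
-- makes it 16.
lemma sum_inner_frameMap_normalMap (k l : Fin 3) (z : EuclideanSpace ℝ (Fin 8)) :
    ∑ i : Fin 4 × Fin 4, 2 * inner ℝ (mulA i.1 z) (normalMap k (mulA i.2 z)) *
      (2 * inner ℝ (mulA i.1 z) (normalMap l (mulA i.2 z))) =
    if k = l then 16 * ((∑ i : Fin 4, z (Fin.castAdd 4 i) ^ 2) ^ 2 +
      (∑ i : Fin 4, z (Fin.natAdd 4 i) ^ 2) ^ 2) else 0 := by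
  obtain ⟨g0, g1, g2, g3⟩ := mulA_coords z
  have h (w) := normalMap_coords w
  have e (i : Fin 4) : (Fin.castAdd 4 i : Fin 8) = ![0, 1, 2, 3] i := by fin_cases i <;> rfl
  have e' (i : Fin 4) : (Fin.natAdd 4 i : Fin 8) = ![4, 5, 6, 7] i := by fin_cases i <;> rfl
  rw [Fintype.sum_prod_type]
  fin_cases k <;> fin_cases l <;>
    simp only [Fin.zero_eta, Fin.mk_one, Fin.reduceFinMk, h, g0, g1, g2, g3,
      PiLp.inner_apply, Fin.sum_univ_eight, Fin.sum_univ_four, e, e'] <;> simp <;> ring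

/-- The flow `(t, z) ↦ cos t z + sin t A z` on the sphere of a linear complex structure `A`. -/
def circleFlow {A : EuclideanSpace ℝ (Fin 8) →L[ℝ] EuclideanSpace ℝ (Fin 8)}
    (hA : ∀ z, inner ℝ z (A z) = 0) (hA2 : ∀ z, inner ℝ (A z) (A z) = ‖z‖ ^ 2) : ℝ × S7 → S7 :=
  Set.codRestrict (fun p => Real.cos p.1 • (p.2 : EuclideanSpace ℝ (Fin 8)) +
    Real.sin p.1 • A p.2) _ (fun p => by
      have h : ‖(p.2 : EuclideanSpace ℝ (Fin 8))‖ = 1 := norm_eq_of_mem_sphere p.2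
      have h2 := hA2 (p.2 : EuclideanSpace ℝ (Fin 8))
      rw [mem_sphere_zero_iff_norm, ← sq_eq_sq₀ (norm_nonneg _) zero_le_one,
        ← real_inner_self_eq_norm_sq]
      simp only [inner_add_left, inner_add_right, inner_smul_left, inner_smul_right,
        hA, real_inner_comm (p.2 : EuclideanSpace ℝ (Fin 8)) (A p.2), h2, h]
      simp
      nlinarith [Real.sin_sq_add_cos_sq p.1])

section Flow

variable {A : EuclideanSpace ℝ (Fin 8) →L[ℝ] EuclideanSpace ℝ (Fin 8)}
  (hA : ∀ z, inner ℝ z (A z) = 0) (hA2 : ∀ z, inner ℝ (A z) (A z) = ‖z‖ ^ 2)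

lemma circleFlow_smooth : ContMDiff (𝓘(ℝ, ℝ).prod (𝓡 7)) (𝓡 7) ∞ (circleFlow hA hA2) := by
  refine ContMDiff.codRestrict_sphere ?_ _
  have h2 : ContMDiff (𝓘(ℝ, ℝ).prod (𝓡 7)) 𝓘(ℝ, EuclideanSpace ℝ (Fin 8)) ∞
      (fun p : ℝ × S7 => (p.2 : EuclideanSpace ℝ (Fin 8))) :=
    contMDiff_coe_sphere.comp contMDiff_snd
  have hc : ContMDiff (𝓘(ℝ, ℝ).prod (𝓡 7)) 𝓘(ℝ, ℝ) ∞ (fun p : ℝ × S7 => Real.cos p.1) :=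
    Real.contDiff_cos.contMDiff.comp contMDiff_fst
  have hs : ContMDiff (𝓘(ℝ, ℝ).prod (𝓡 7)) 𝓘(ℝ, ℝ) ∞ (fun p : ℝ × S7 => Real.sin p.1) :=
    Real.contDiff_sin.contMDiff.comp contMDiff_fst
  exact (hc.smul h2).add (hs.smul (A.contDiff.contMDiff.comp h2))

lemma dIncl_mfderiv_circleFlow (z : S7) :
    dIncl (circleFlow hA hA2 (0, z)) (mfderiv (𝓘(ℝ, ℝ).prod (𝓡 7)) (𝓡 7) (circleFlow hA hA2) (0, z)
      ((1, 0) : ℝ × EuclideanSpace ℝ (Fin 7))) = A z := by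
  have hF : MDifferentiableAt (𝓘(ℝ, ℝ).prod (𝓡 7)) (𝓡 7) (circleFlow hA hA2) (0, z) :=
    (circleFlow_smooth hA hA2).mdifferentiableAt (by simp)
  have hι : MDifferentiableAt (𝓡 7) 𝓘(ℝ, EuclideanSpace ℝ (Fin 8))
      ((↑) : S7 → EuclideanSpace ℝ (Fin 8)) (circleFlow hA hA2 (0, z)) :=
    (contMDiff_coe_sphere (m := 1)).mdifferentiableAt one_ne_zero
  have hc : HasMFDerivAt 𝓘(ℝ, ℝ) (𝓘(ℝ, ℝ).prod (𝓡 7)) (fun t : ℝ => (t, z)) 0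
      (ContinuousLinearMap.inl ℝ ℝ (EuclideanSpace ℝ (Fin 7))) := by
    have h : MDifferentiableAt 𝓘(ℝ, ℝ) (𝓘(ℝ, ℝ).prod (𝓡 7)) (fun t : ℝ => (t, z)) 0 :=
      mdifferentiableAt_id.prodMk mdifferentiableAt_const
    have h2 := h.hasMFDerivAt
    rw [mfderiv_prod_left] at h2
    exact h2
  have h1 := (hι.hasMFDerivAt.comp (0, z) hF.hasMFDerivAt).comp (0 : ℝ) hc
  have h2 : HasDerivAt (fun t : ℝ => Real.cos t • (z : EuclideanSpace ℝ (Fin 8)) +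
      Real.sin t • A z) (A z) 0 := by
    have := ((Real.hasDerivAt_cos 0).smul_const (z : EuclideanSpace ℝ (Fin 8))).fun_add
      ((Real.hasDerivAt_sin 0).smul_const (A z))
    simpa using this
  have h3 := hasMFDerivAt_unique h1 h2.hasFDerivAt.hasMFDerivAt
  have h4 := congrArg (fun L : ℝ →L[ℝ] EuclideanSpace ℝ (Fin 8) => L 1) h3
  refine Eq.trans ?_ (h4.trans ?_)
  · rfl
  · exact one_smul ℝ _

end Flow

/-- The field is the velocity at time zero of the smooth flow `circleFlow`. It is thus the tangent
map of the flow composed with the smooth section `z ↦ (∂ₜ at 0, 0 at z)`. -/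
lemma smoothFieldAt_of_dIncl_eq {A : EuclideanSpace ℝ (Fin 8) →L[ℝ] EuclideanSpace ℝ (Fin 8)}
    (hA : ∀ z, inner ℝ z (A z) = 0) (hA2 : ∀ z, inner ℝ (A z) (A z) = ‖z‖ ^ 2)
    {V : (z : S7) → TangentSpace (𝓡 7) z} (hV : ∀ z, dIncl z (V z) = A z) (z : S7) :
    SmoothFieldAt V z := by
  have hv (z w : S7) (hw : w = z) (v : TangentSpace (𝓡 7) w) (h : dIncl w v = A z) :
      (⟨z, V z⟩ : TangentBundle (𝓡 7) S7) = ⟨w, v⟩ := by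
    subst hw
    rw [injective_mvfderiv_subtypeVal_sphere w ((hV w).trans h.symm)]
  have h0 (z : S7) : circleFlow hA hA2 (0, z) = z := Subtype.ext (by simp [circleFlow])
  have h1 : ContMDiff (𝓡 7) ((𝓘(ℝ, ℝ).tangent).prod (𝓡 7).tangent) ∞ (fun z : S7 =>
      ((⟨0, 1⟩ : TangentBundle 𝓘(ℝ, ℝ) ℝ), (⟨z, 0⟩ : TangentBundle (𝓡 7) S7))) :=
    contMDiff_const.prodMk
      (Bundle.contMDiff_zeroSection ℝ (TangentSpace (𝓡 7) : S7 → Type _))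
  have h2 := ((circleFlow_smooth hA hA2).contMDiff_tangentMap (m := ∞) (by simp)).comp
    ((contMDiff_equivTangentBundleProd_symm (I := 𝓘(ℝ, ℝ)) (I' := 𝓡 7) (M := ℝ) (M' := S7)
      (n := ∞)).comp h1)
  refine ContMDiffAt.congr_of_eventuallyEq (h2 z) (Filter.Eventually.of_forall fun p => ?_)
  exact hv p _ (h0 p) _ (dIncl_mfderiv_circleFlow hA hA2 p)

lemma frameMap_mem_range (i : Fin 4 ⊕ Fin 3) (z : S7) :
    frameMap i z ∈ (dIncl z).toLinearMap.range := by
  have h : (dIncl z).toLinearMap.range = _ := range_mvfderiv_subtypeVal z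
  rw [h, Submodule.mem_orthogonal_singleton_iff_inner_right]
  exact inner_frameMap_self i z

/-- The adapted orthonormal frame of the sphere: the canonical vector fields followed by three
normal ones. -/
def frameField (i : Fin 4 ⊕ Fin 3) (z : S7) : TangentSpace (𝓡 7) z :=
  (LinearEquiv.ofInjective (dIncl z).toLinearMap (injective_mvfderiv_subtypeVal_sphere z)).symm
    ⟨frameMap i z, frameMap_mem_range i z⟩

lemma dIncl_frameField (i : Fin 4 ⊕ Fin 3) (z : S7) : dIncl z (frameField i z) = frameMap i z := by
  have h := (LinearEquiv.ofInjective (dIncl z).toLinearMap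
    (injective_mvfderiv_subtypeVal_sphere z)).apply_symm_apply
    ⟨frameMap i z, frameMap_mem_range i z⟩
  exact congrArg Subtype.val h

lemma frameField_smooth (i : Fin 4 ⊕ Fin 3) (z : S7) : SmoothFieldAt (frameField i) z :=
  smoothFieldAt_of_dIncl_eq (inner_frameMap_self i)
    (fun z => by simpa using inner_frameMap_frameMap i i z) (dIncl_frameField i) z

lemma norm_coe_S7 (z : S7) : ‖(z : EuclideanSpace ℝ (Fin 8))‖ = 1 := norm_eq_of_mem_sphere z

lemma inner_frameMap_frameMap_coe (i j : Fin 4 ⊕ Fin 3) (z : S7) :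
    inner ℝ (frameMap i z) (frameMap j z) = if i = j then (1 : ℝ) else 0 := by
  simpa [norm_coe_S7] using inner_frameMap_frameMap i j z

/-- The coordinates of a tangent vector in the adapted frame. -/
def frameCoord (i : Fin 4 ⊕ Fin 3) (z : S7) : TangentSpace (𝓡 7) z →ₗ[ℝ] ℝ :=
  (innerₗ (EuclideanSpace ℝ (Fin 8)) (frameMap i z)) ∘ₗ (dIncl z).toLinearMap

lemma frameCoord_apply (i : Fin 4 ⊕ Fin 3) (z : S7) (v : TangentSpace (𝓡 7) z) :
    frameCoord i z v = inner ℝ (frameMap i z) (dIncl z v) := rfl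

lemma frameCoord_frameField (i j : Fin 4 ⊕ Fin 3) (z : S7) :
    frameCoord i z (frameField j z) = if i = j then 1 else 0 := by
  rw [frameCoord_apply, dIncl_frameField, inner_frameMap_frameMap_coe]

lemma linearIndependent_frameField (z : S7) :
    LinearIndependent ℝ (fun i => frameField i z) := by
  rw [Fintype.linearIndependent_iff]
  intro g hg i
  have := congrArg (frameCoord i z) hg
  simpa only [map_sum, map_smul, frameCoord_frameField, smul_eq_mul, mul_ite, mul_one, mul_zero,
    Finset.sum_ite_eq, Finset.mem_univ, if_true, map_zero] using this

/-- The adapted frame as a basis of the tangent space. -/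
def frameBasis (z : S7) : Module.Basis (Fin 4 ⊕ Fin 3) ℝ (TangentSpace (𝓡 7) z) :=
  basisOfLinearIndependentOfCardEqFinrank (linearIndependent_frameField z) (by
    change _ = Module.finrank ℝ (EuclideanSpace ℝ (Fin 7))
    simp)

lemma coe_frameBasis (z : S7) : ⇑(frameBasis z) = fun i => frameField i z :=
  coe_basisOfLinearIndependentOfCardEqFinrank _ _

lemma frameBasis_repr (z : S7) (v : TangentSpace (𝓡 7) z) (i : Fin 4 ⊕ Fin 3) :
    (frameBasis z).repr v i = frameCoord i z v := by
  conv_rhs => rw [← (frameBasis z).sum_repr v]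
  simp only [map_sum, map_smul, coe_frameBasis, frameCoord_frameField, smul_eq_mul, mul_ite,
    mul_one, mul_zero, Finset.sum_ite_eq, Finset.mem_univ, if_true]

lemma sum_frameCoord_smul (z : S7) (v : TangentSpace (𝓡 7) z) :
    ∑ i, frameCoord i z v • frameField i z = v := by
  have := (frameBasis z).sum_repr v
  simpa only [frameBasis_repr, coe_frameBasis] using this

lemma mem_horizontalT_iff (z : S7) (v : TangentSpace (𝓡 7) z) :
    v ∈ horizontalT z ↔ ∀ k, frameCoord (Sum.inr k) z v = 0 := by
  constructor
  · intro h k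
    have h2 : horizontalT z ≤ LinearMap.ker (frameCoord (Sum.inr k) z) := by
      rw [horizontalT, Submodule.span_le]
      rintro _ ⟨i, rfl⟩
      change frameCoord (Sum.inr k) z (frameField (Sum.inl i) z) = 0
      simp [frameCoord_frameField]
    exact h2 h
  · intro h
    rw [← sum_frameCoord_smul z v, Fintype.sum_sum_type]
    simp only [h, zero_smul, Finset.sum_const_zero, add_zero]
    exact Submodule.sum_mem _ fun i _ => Submodule.smul_mem _ _ (Submodule.subset_span ⟨i, rfl⟩)

end Frame

/-! ### Frame components of Lie brackets -/

section Bracket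

lemma contMDiff_coe_S7 :
    ContMDiff (𝓡 7) 𝓘(ℝ, EuclideanSpace ℝ (Fin 8)) ∞ ((↑) : S7 → EuclideanSpace ℝ (Fin 8)) :=
  contMDiff_coe_sphere

lemma mvfderiv_clm_coe (A : EuclideanSpace ℝ (Fin 8) →L[ℝ] EuclideanSpace ℝ (Fin 8)) (q : S7)
    (v : TangentSpace (𝓡 7) q) :
    mvfderiv (𝓡 7) (fun p : S7 => A p) q v = A (dIncl q v) := by
  rw [mvfderiv_comp_fderiv (g := A) A.differentiableAt
    (contMDiff_coe_S7.mdifferentiableAt (by simp)), A.fderiv]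

variable {V W : (p : S7) → TangentSpace (𝓡 7) p} {q : S7}

lemma SmoothFieldAt.mdifferentiableAt_dIncl (hV : SmoothFieldAt V q) :
    MDifferentiableAt (𝓡 7) 𝓘(ℝ, EuclideanSpace ℝ (Fin 8)) (fun p => dIncl p (V p)) q :=
  (hV.contMDiffAt_mvfderiv contMDiff_coe_S7).mdifferentiableAt (by simp)

lemma SmoothFieldAt.contMDiffAt_frameCoord (hV : SmoothFieldAt V q) (i : Fin 4 ⊕ Fin 3) :
    ContMDiffAt (𝓡 7) 𝓘(ℝ, ℝ) ∞ (fun p => frameCoord i p (V p)) q := by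
  have h1 : ContMDiffAt (𝓡 7) 𝓘(ℝ, EuclideanSpace ℝ (Fin 8)) ∞ (fun p : S7 => frameMap i p) q :=
    ((frameMap i).contDiff.contMDiff.comp contMDiff_coe_S7) q
  have h2 := h1.prodMk_space (hV.contMDiffAt_mvfderiv contMDiff_coe_S7)
  have h3 : ContDiff ℝ ∞ (fun p : EuclideanSpace ℝ (Fin 8) × EuclideanSpace ℝ (Fin 8) =>
      (inner ℝ p.1 p.2 : ℝ)) := contDiff_fst.inner ℝ contDiff_snd
  exact h3.contMDiff.contMDiffAt.comp q h2

lemma SmoothFieldAt.mvfderiv_frameCoord (hV : SmoothFieldAt V q) (i : Fin 4 ⊕ Fin 3)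
    (v : TangentSpace (𝓡 7) q) :
    mvfderiv (𝓡 7) (fun p => frameCoord i p (V p)) q v =
      inner ℝ (frameMap i q) (mvfderiv (𝓡 7) (fun p => dIncl p (V p)) q v) +
        inner ℝ (frameMap i (dIncl q v)) (dIncl q (V q)) := by
  have h1 : MDifferentiableAt (𝓡 7) 𝓘(ℝ, EuclideanSpace ℝ (Fin 8)) (fun p : S7 => frameMap i p) q :=
    ((frameMap i).contDiff.contMDiff.comp contMDiff_coe_S7).mdifferentiableAt
      (n := ∞) (by simp)
  have := mvfderiv_inner h1 hV.mdifferentiableAt_dIncl v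
  rw [mvfderiv_clm_coe] at this
  exact this

/-- In `ℝ⁸` the bracket is `V(W) - W(V)`; the product rule replaces `⟨F_i, V(W)⟩` by the derivative
of the coordinate of `W` minus the term where `F_i` is differentiated. -/
lemma frameCoord_mlieBracket (hV : SmoothFieldAt V q) (hW : SmoothFieldAt W q)
    (i : Fin 4 ⊕ Fin 3) :
    frameCoord i q (VectorField.mlieBracket (𝓡 7) V W q) =
      mvfderiv (𝓡 7) (fun p => frameCoord i p (W p)) q (V q) -
        (inner ℝ (frameMap i (dIncl q (V q))) (dIncl q (W q)) +
        inner ℝ (frameMap i q) (mvfderiv (𝓡 7) (fun p => dIncl p (V p)) q (W q))) := by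
  rw [frameCoord_apply, mvfderiv_mlieBracket hV hW contMDiff_coe_S7, inner_sub_right,
    hW.mvfderiv_frameCoord]
  ring

/-- The normal coordinates of `V` and `W` vanish identically, so only the derivatives of the linear
field `N_k` survive. By skew-symmetry the two such terms are equal, whence the factor 2. -/
lemma frameCoord_mlieBracket_of_horizontal (hV : SmoothFieldAt V q) (hW : SmoothFieldAt W q)
    (hV' : ∀ p, V p ∈ horizontalT p) (hW' : ∀ p, W p ∈ horizontalT p) (k : Fin 3) :
    frameCoord (Sum.inr k) q (VectorField.mlieBracket (𝓡 7) V W q) =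
      2 * inner ℝ (dIncl q (V q)) (normalMap k (dIncl q (W q))) := by
  have h0 (U : (p : S7) → TangentSpace (𝓡 7) p) (hU : ∀ p, U p ∈ horizontalT p) :
      (fun p => frameCoord (Sum.inr k) p (U p)) = fun _ => 0 :=
    funext fun p => (mem_horizontalT_iff p _).1 (hU p) k
  have h1 := hV.mvfderiv_frameCoord (Sum.inr k) (W q)
  rw [h0 V hV', mvfderiv_const] at h1
  rw [frameCoord_mlieBracket hV hW, h0 W hW', mvfderiv_const]
  have h2 := inner_frameMap_eq_neg (Sum.inr k) (dIncl q (V q)) (dIncl q (W q))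
  have h3 : inner ℝ (frameMap (Sum.inr k) (dIncl q (W q))) (dIncl q (V q)) =
    inner ℝ (dIncl q (V q)) (normalMap k (dIncl q (W q))) := real_inner_comm _ _
  have h4 : inner ℝ (dIncl q (V q)) (frameMap (Sum.inr k) (dIncl q (W q))) =
    inner ℝ (dIncl q (V q)) (normalMap k (dIncl q (W q))) := rfl
  simp only [zero_apply] at h1 ⊢
  linarith

end Bracket

/-! ### The Levi map and the quotient inner product -/

section Levi

/-- The rank-one pieces of the Levi form: `(V, W) ↦ 2 ⟨V, N W⟩`. -/
def leviCoef (k : Fin 3) (q : S7) : LinearMap.BilinForm ℝ (TangentSpace (𝓡 7) q) :=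
  (2 : ℝ) • (innerₗ (EuclideanSpace ℝ (Fin 8))).compl₁₂ (dIncl q).toLinearMap
    ((normalMap k).toLinearMap ∘ₗ (dIncl q).toLinearMap)

lemma leviCoef_apply (k : Fin 3) (q : S7) (v w : TangentSpace (𝓡 7) q) :
    leviCoef k q v w = 2 * inner ℝ (dIncl q v) (normalMap k (dIncl q w)) := rfl

/-- The class of a normal frame vector in `T_q / H_q`. -/
def normalClass (k : Fin 3) (q : S7) : TangentSpace (𝓡 7) q ⧸ S7T.horizontal q :=
  (S7T.horizontal q).mkQ (frameField (Sum.inr k) q)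

lemma mkQ_eq_sum (q : S7) (v : TangentSpace (𝓡 7) q) :
    (S7T.horizontal q).mkQ v = ∑ k, frameCoord (Sum.inr k) q v • normalClass k q := by
  conv_lhs => rw [← sum_frameCoord_smul q v, Fintype.sum_sum_type, map_add]
  have : (S7T.horizontal q).mkQ (∑ i, frameCoord (Sum.inl i) q v • frameField (Sum.inl i) q) = 0 :=
    (Submodule.Quotient.mk_eq_zero _).2 (Submodule.sum_mem _ fun i _ =>
      Submodule.smul_mem _ _ (Submodule.subset_span ⟨i, rfl⟩))
  rw [this, zero_add, map_sum]
  simp only [map_smul, normalClass]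

lemma sum_smul_normalClass_inj (q : S7) {c d : Fin 3 → ℝ}
    (h : ∑ k, c k • normalClass k q = ∑ k, d k • normalClass k q) : c = d := by
  funext l
  have h1 : ∑ k, (c k - d k) • frameField (Sum.inr k) q ∈ horizontalT q := by
    refine (Submodule.Quotient.mk_eq_zero (S7T.horizontal q)).1 ?_
    change (S7T.horizontal q).mkQ _ = 0
    simp only [sub_smul, Finset.sum_sub_distrib]
    exact sub_eq_zero.2 h
  have h2 := (mem_horizontalT_iff q _).1 h1 l
  simp only [map_sum, map_smul, frameCoord_frameField, smul_eq_mul, mul_ite, mul_one, mul_zero,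
    Sum.inr.injEq, Finset.sum_ite_eq, Finset.mem_univ, if_true] at h2
  linarith

/-- The Levi map of the trivializable structure. -/
def leviMap (q : S7) : (S7T.horizontal q ⊗[ℝ] S7T.horizontal q) →ₗ[ℝ]
    (TangentSpace (𝓡 7) q ⧸ S7T.horizontal q) :=
  ∑ k, (TensorProduct.lift ((leviCoef k q).compl₁₂ (S7T.horizontal q).subtype
    (S7T.horizontal q).subtype)).smulRight (normalClass k q)

lemma leviMap_tmul (q : S7) (v w : S7T.horizontal q) :
    leviMap q (v ⊗ₜ[ℝ] w) = ∑ k, leviCoef k q v w • normalClass k q := by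
  simp [leviMap]

lemma leviMap_eq_mlieBracket (q : S7) (V W : (p : S7) → S7T.horizontal p)
    (hV : SmoothFieldAt (fun p => (V p : TangentSpace (𝓡 7) p)) q)
    (hW : SmoothFieldAt (fun p => (W p : TangentSpace (𝓡 7) p)) q) :
    leviMap q (V q ⊗ₜ[ℝ] W q) = (S7T.horizontal q).mkQ
      (VectorField.mlieBracket (𝓡 7) (fun p => (V p : TangentSpace (𝓡 7) p))
        (fun p => (W p : TangentSpace (𝓡 7) p)) q) := by
  rw [mkQ_eq_sum, leviMap_tmul]
  refine Finset.sum_congr rfl fun k _ => ?_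
  rw [frameCoord_mlieBracket_of_horizontal hV hW (fun p => (V p).2) (fun p => (W p).2),
    leviCoef_apply]

/-- The canonical vector fields as sections of the distribution. -/
def horizontalField (i : Fin 4) (q : S7) : S7T.horizontal q :=
  ⟨fieldX i q, Submodule.subset_span ⟨i, rfl⟩⟩

lemma metric_apply (q : S7) (v w : S7T.horizontal q) :
    S7T.metric q v w = inner ℝ (dIncl q v) (dIncl q w) := rfl

lemma metric_horizontalField_left (q : S7) (i : Fin 4) (v : S7T.horizontal q) :
    S7T.metric q (horizontalField i q) v = frameCoord (Sum.inl i) q v := by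
  rw [metric_apply]
  change inner ℝ (dIncl q (frameField (Sum.inl i) q)) _ = _
  rw [dIncl_frameField, frameCoord_apply]

lemma metric_horizontalField (q : S7) (i j : Fin 4) :
    S7T.metric q (horizontalField i q) (horizontalField j q) = if i = j then 1 else 0 := by
  rw [metric_horizontalField_left]
  change frameCoord (Sum.inl i) q (frameField (Sum.inl j) q) = _
  simp [frameCoord_frameField]

lemma sum_smul_horizontalField (q : S7) (v : S7T.horizontal q) :
    ∑ i, frameCoord (Sum.inl i) q v • horizontalField i q = v := by
  apply Subtype.ext
  have h := sum_frameCoord_smul q (v : TangentSpace (𝓡 7) q)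
  rw [Fintype.sum_sum_type] at h
  simp only [(mem_horizontalT_iff q _).1 v.2, zero_smul, Finset.sum_const_zero, add_zero] at h
  rw [AddSubmonoidClass.coe_finsetSum]
  exact h

lemma linearIndependent_horizontalField (q : S7) :
    LinearIndependent ℝ fun i => horizontalField i q := by
  rw [Fintype.linearIndependent_iff]
  intro g hg i
  have := congrArg (S7T.metric q (horizontalField i q)) hg
  simpa only [map_sum, map_smul, metric_horizontalField, smul_eq_mul, mul_ite, mul_one, mul_zero,
    Finset.sum_ite_eq, Finset.mem_univ, if_true, map_zero] using this

/-- The canonical vector fields as a basis of the distribution. -/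
def horizontalBasis (q : S7) : Module.Basis (Fin 4) ℝ (S7T.horizontal q) :=
  Module.Basis.mk (linearIndependent_horizontalField q) fun v _ => by
    rw [← sum_smul_horizontalField q v]
    exact Submodule.sum_mem _ fun i _ => Submodule.smul_mem _ _ (Submodule.subset_span ⟨i, rfl⟩)

lemma coe_horizontalBasis (q : S7) : ⇑(horizontalBasis q) = fun i => horizontalField i q :=
  Module.Basis.coe_mk _ _

lemma horizontalField_smooth (i : Fin 4) (q : S7) :
    SmoothFieldAt (fun p => (horizontalField i p : TangentSpace (𝓡 7) p)) q :=
  fieldX_smooth i q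

/-- The fields `X_i` are smooth sections forming a basis at `q`, so the bracket condition fixes the
map on a basis of the tensor square. -/
lemma IsLeviMap.eq_leviMap {q : S7} {L : (S7T.horizontal q ⊗[ℝ] S7T.horizontal q) →ₗ[ℝ]
    (TangentSpace (𝓡 7) q ⧸ S7T.horizontal q)} (hL : S7T.IsLeviMap q L) : L = leviMap q := by
  refine ((horizontalBasis q).tensorProduct (horizontalBasis q)).ext fun ⟨i, j⟩ => ?_
  rw [Module.Basis.tensorProduct_apply, coe_horizontalBasis]
  have h1 := hL.2 (horizontalField i) (horizontalField j) (horizontalField_smooth i q)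
    (horizontalField_smooth j q)
  have h2 := leviMap_eq_mlieBracket q (horizontalField i) (horizontalField j)
    (horizontalField_smooth i q) (horizontalField_smooth j q)
  exact h1.trans h2.symm

/-- The constant of proportionality `16 (‖x‖⁴ + ‖y‖⁴)` between the inner products on
`T_q / H_q` induced by the metric of the sphere and by the Lie bracket. -/
def leviScale (q : S7) : ℝ :=
  16 * ((∑ i : Fin 4, (q : EuclideanSpace ℝ (Fin 8)) (Fin.castAdd 4 i) ^ 2) ^ 2 +
    (∑ i : Fin 4, (q : EuclideanSpace ℝ (Fin 8)) (Fin.natAdd 4 i) ^ 2) ^ 2)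

lemma sum_sq_add_sum_sq (q : S7) :
    (∑ i : Fin 4, (q : EuclideanSpace ℝ (Fin 8)) (Fin.castAdd 4 i) ^ 2) +
      (∑ i : Fin 4, (q : EuclideanSpace ℝ (Fin 8)) (Fin.natAdd 4 i) ^ 2) = 1 := by
  have h := EuclideanSpace.real_norm_sq_eq (q : EuclideanSpace ℝ (Fin 8))
  rw [norm_coe_S7, one_pow] at h
  exact (h.trans
    (Fin.sum_univ_add (fun i : Fin (4 + 4) => (q : EuclideanSpace ℝ (Fin 8)) i ^ 2))).symm

lemma leviScale_eq (q : S7) : leviScale q =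
    16 * (1 - 2 * (∑ i : Fin 4, (q : EuclideanSpace ℝ (Fin 8)) (Fin.castAdd 4 i) ^ 2) *
      (∑ i : Fin 4, (q : EuclideanSpace ℝ (Fin 8)) (Fin.natAdd 4 i) ^ 2)) := by
  have h := sum_sq_add_sum_sq q
  rw [leviScale]
  -- With `s = ‖x‖² + ‖y‖²`, the difference of the two sides is `16(s² - 1) = 16(1 + s)(s - 1)`.
  linear_combination 16 * (1 + ((∑ i : Fin 4, (q : EuclideanSpace ℝ (Fin 8)) (Fin.castAdd 4 i) ^ 2) +
      (∑ i : Fin 4, (q : EuclideanSpace ℝ (Fin 8)) (Fin.natAdd 4 i) ^ 2))) * h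

lemma leviScale_pos (q : S7) : 0 < leviScale q := by
  have h := sum_sq_add_sum_sq q
  rw [leviScale]
  nlinarith [sq_nonneg ((∑ i : Fin 4, (q : EuclideanSpace ℝ (Fin 8)) (Fin.castAdd 4 i) ^ 2) -
      (∑ i : Fin 4, (q : EuclideanSpace ℝ (Fin 8)) (Fin.natAdd 4 i) ^ 2))]

lemma leviCoef_fieldX (k : Fin 3) (q : S7) (i j : Fin 4) :
    leviCoef k q (fieldX i q) (fieldX j q) =
      2 * inner ℝ (mulA i q) (normalMap k (mulA j q)) := by
  rw [leviCoef_apply, dIncl_fieldX, dIncl_fieldX]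

lemma sum_leviCoef_mul (q : S7) (k l : Fin 3) :
    ∑ i : Fin 4 × Fin 4, leviCoef k q (fieldX i.1 q) (fieldX i.2 q) *
      leviCoef l q (fieldX i.1 q) (fieldX i.2 q) = if k = l then leviScale q else 0 := by
  simp only [leviCoef_fieldX]
  exact sum_inner_frameMap_normalMap k l q

/-- The least norm of a solution of a linear system with orthogonal rows of equal norm. -/
lemma isLeast_sum_sq {ι κ : Type*} [Fintype ι] [Fintype κ] [DecidableEq κ] {m : κ → ι → ℝ} {l : ℝ}
    (hl : 0 < l) (hm : ∀ j k, ∑ i, m j i * m k i = if j = k then l else 0) (d : κ → ℝ) :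
    IsLeast {r : ℝ | ∃ c : ι → ℝ, (fun k => ∑ i, c i * m k i) = d ∧ r = ∑ i, c i ^ 2}
      ((∑ k, d k ^ 2) / l) := by
  -- The minimizer `c₀ = ∑ (d k / l) m k` lies in the span of the rows, so `⟨c, c₀⟩` is the same for
  -- every solution `c`. Then `‖c - c₀‖² ≥ 0` yields `‖c‖² ≥ ‖c₀‖²`.
  have hcross (c : ι → ℝ) (hc : ∀ k, ∑ i, c i * m k i = d k) :
      ∑ i, c i * ∑ k, d k / l * m k i = (∑ k, d k ^ 2) / l := by
    simp only [Finset.mul_sum]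
    rw [Finset.sum_comm, Finset.sum_div]
    refine Finset.sum_congr rfl fun k _ => ?_
    have : ∑ i, c i * (d k / l * m k i) = d k / l * ∑ i, c i * m k i := by
      rw [Finset.mul_sum]
      exact Finset.sum_congr rfl fun i _ => by ring
    rw [this, hc]
    ring
  have hsol (k : κ) : ∑ i, (∑ j, d j / l * m j i) * m k i = d k := by
    simp only [Finset.sum_mul]
    rw [Finset.sum_comm]
    have (j : κ) : ∑ i, d j / l * m j i * m k i = if j = k then d j else 0 := by
      simp only [mul_assoc, ← Finset.mul_sum, hm]
      split_ifs
      · field_simp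
      · simp
    simp [this]
  refine ⟨⟨fun i => ∑ k, d k / l * m k i, funext hsol, ?_⟩, ?_⟩
  · rw [← hcross _ hsol]
    exact Finset.sum_congr rfl fun i _ => (sq _).symm
  · rintro r ⟨c, hc, rfl⟩
    have h1 := hcross c (fun k => congrFun hc k)
    have h2 := hcross _ hsol
    have h3 : 0 ≤ ∑ i, (c i - ∑ k, d k / l * m k i) ^ 2 :=
      Finset.sum_nonneg fun i _ => sq_nonneg _
    have h4 : ∑ i, (c i - ∑ k, d k / l * m k i) ^ 2 = ∑ i, c i ^ 2 -
        2 * ∑ i, c i * ∑ k, d k / l * m k i +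
        ∑ i, (∑ k, d k / l * m k i) * ∑ k, d k / l * m k i := by
      rw [Finset.mul_sum, ← Finset.sum_sub_distrib, ← Finset.sum_add_distrib]
      exact Finset.sum_congr rfl fun i _ => by ring
    linarith

/-- The products of the `X_i` are an orthonormal basis of the tensor square, so in coordinates this
is the least-norm problem of `isLeast_sum_sq`, whose rows are the arrays of `leviCoef`. -/
lemma isQuotientNormSq_leviMap (q : S7) (d : Fin 3 → ℝ) :
    S7T.IsQuotientNormSq q (leviMap q) (∑ k, d k • normalClass k q)
      ((∑ k, d k ^ 2) / leviScale q) := by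
  have h := isLeast_sum_sq (leviScale_pos q) (sum_leviCoef_mul q) d
  rw [SubRiemannianStructure.IsQuotientNormSq]
  let b := (horizontalBasis q).tensorProduct (horizontalBasis q)
  have hb (i : Fin 4 × Fin 4) : b i = horizontalField i.1 q ⊗ₜ[ℝ] horizontalField i.2 q := by
    simp only [b, Module.Basis.tensorProduct_apply', coe_horizontalBasis]
  have hL (c : Fin 4 × Fin 4 → ℝ) : leviMap q (∑ i, c i • b i) =
      ∑ k, (∑ i, c i * leviCoef k q (fieldX i.1 q) (fieldX i.2 q)) • normalClass k q := by
    simp only [map_sum, map_smul, hb, leviMap_tmul, Finset.sum_smul, Finset.smul_sum, smul_smul]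
    rw [Finset.sum_comm]
    rfl
  have hN (c : Fin 4 × Fin 4 → ℝ) : (S7T.metric q).tmul (S7T.metric q) (∑ i, c i • b i)
      (∑ i, c i • b i) = ∑ i, c i ^ 2 := by
    have h1 (i j : Fin 4 × Fin 4) : (S7T.metric q).tmul (S7T.metric q) (b i) (b j) =
        if i = j then 1 else 0 := by
      rw [hb, hb, LinearMap.BilinForm.tensorDistrib_tmul, metric_horizontalField, metric_horizontalField]
      simp [Prod.ext_iff, ite_and]
    simp only [map_sum, map_smul, LinearMap.sum_apply, LinearMap.smul_apply, h1, smul_eq_mul]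
    simp [sq]
  convert h using 1
  ext r
  constructor
  · rintro ⟨ξ, h1, rfl⟩
    refine ⟨b.repr ξ, ?_, ?_⟩
    · rw [← b.sum_repr ξ, hL] at h1
      exact sum_smul_normalClass_inj q h1
    · rw [← hN, b.sum_repr]
  · rintro ⟨c, h1, rfl⟩
    refine ⟨∑ i, c i • b i, ?_, (hN c).symm⟩
    rw [hL, ← h1]

lemma isLeviMap_leviMap (q : S7) : S7T.IsLeviMap q (leviMap q) := by
  refine ⟨fun ζ => ?_, leviMap_eq_mlieBracket q⟩
  obtain ⟨v, rfl⟩ := (S7T.horizontal q).mkQ_surjective ζ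
  rw [mkQ_eq_sum]
  -- A least-norm solution is attained; in particular a preimage exists.
  obtain ⟨⟨ξ, h, -⟩, -⟩ := isQuotientNormSq_leviMap q fun k => frameCoord (Sum.inr k) q v
  exact ⟨ξ, h⟩

end Levi

/-! ### Variation of a determinant under a row transformation -/

section Determinant

variable {ι : Type*} [Fintype ι] [DecidableEq ι]

/-- The determinant as a continuous multilinear map of the rows. -/
def detRowCMM (ι : Type*) [Fintype ι] [DecidableEq ι] :
    ContinuousMultilinearMap ℝ (fun _ : ι => ι → ℝ) ℝ where
  toMultilinearMap := (Matrix.detRowAlternating (n := ι) (R := ℝ)).toMultilinearMap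
  cont := Continuous.matrix_det (A := fun a : ι → ι → ℝ => Matrix.of a) continuous_id

lemma detRowCMM_apply (a : ι → ι → ℝ) : detRowCMM ι a = (Matrix.of a).det := rfl

/-- Replacing in turn each row of `a` by its image under `K` multiplies the determinant by the
trace of `K`. -/
lemma sum_det_updateRow_mul (a K : Matrix ι ι ℝ) :
    ∑ i, (a.updateRow i ((a * K) i)).det = K.trace * a.det := by
  -- Cramer's rule: replacing row `i` by `v` gives the `i`-th entry of `v * adj a`.
  have h (i : ι) : (a.updateRow i ((a * K) i)).det = (a * K * a.adjugate) i i := by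
    rw [← Matrix.cramer_transpose_apply, Matrix.cramer_eq_adjugate_mulVec, Matrix.mulVec,
      ← Matrix.adjugate_transpose, Matrix.mul_apply, dotProduct]
    exact Finset.sum_congr rfl fun j _ => mul_comm _ _
  calc ∑ i, (a.updateRow i ((a * K) i)).det = (a * K * a.adjugate).trace :=
        Finset.sum_congr rfl fun i _ => h i
    _ = (K * (a.adjugate * a)).trace := by
        rw [Matrix.mul_assoc, Matrix.trace_mul_comm, Matrix.mul_assoc]
    _ = K.trace * a.det := by
        rw [Matrix.adjugate_mul]
        simp [mul_comm]

end Determinant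

/-! ### Lie derivative of a top-degree form in the frame -/

section TopForms

/-- The coordinates in the adapted frame of a family of vector fields. -/
def frameMatrix (Y : Fin 4 ⊕ Fin 3 → (p : S7) → TangentSpace (𝓡 7) p) (p : S7) :
    Fin 4 ⊕ Fin 3 → Fin 4 ⊕ Fin 3 → ℝ :=
  fun i j => frameCoord j p (Y i p)

lemma topForm_apply_eq (q : S7) (η : (TangentSpace (𝓡 7) q) [⋀^Fin 4 ⊕ Fin 3]→ₗ[ℝ] ℝ)
    (v : Fin 4 ⊕ Fin 3 → TangentSpace (𝓡 7) q) :
    η v = η (fun i => frameField i q) *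
      (Matrix.of fun i j => frameCoord j q (v i)).det := by
  have h := congrArg (fun f => f v) (η.eq_smul_basis_det (frameBasis q))
  simp only [AlternatingMap.smul_apply, Module.Basis.det_apply, smul_eq_mul, coe_frameBasis] at h
  rw [h, ← Matrix.det_transpose]
  congr 2
  ext i j
  simp [Module.Basis.toMatrix_apply, frameBasis_repr]

variable {Y : Fin 4 ⊕ Fin 3 → (p : S7) → TangentSpace (𝓡 7) p} {q : S7}

lemma contMDiffAt_frameMatrix (hY : ∀ i, SmoothFieldAt (Y i) q) :
    ContMDiffAt (𝓡 7) 𝓘(ℝ, Fin 4 ⊕ Fin 3 → Fin 4 ⊕ Fin 3 → ℝ) ∞ (frameMatrix Y) q :=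
  contMDiffAt_pi_space.2 fun i => contMDiffAt_pi_space.2 fun j => (hY i).contMDiffAt_frameCoord j

lemma mvfderiv_frameMatrix (hY : ∀ i, SmoothFieldAt (Y i) q) (v : TangentSpace (𝓡 7) q)
    (i j : Fin 4 ⊕ Fin 3) :
    mvfderiv (𝓡 7) (frameMatrix Y) q v i j =
      mvfderiv (𝓡 7) (fun p => frameCoord j p (Y i p)) q v := by
  have h := mvfderiv_comp_fderiv (φ := frameMatrix Y) (q := q)
    (g := (ContinuousLinearMap.proj j : (Fin 4 ⊕ Fin 3 → ℝ) →L[ℝ] ℝ) ∘L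
      (ContinuousLinearMap.proj i : (Fin 4 ⊕ Fin 3 → Fin 4 ⊕ Fin 3 → ℝ) →L[ℝ] _))
    (ContinuousLinearMap.differentiableAt _)
    ((contMDiffAt_frameMatrix hY).mdifferentiableAt (by simp)) v
  rw [ContinuousLinearMap.fderiv] at h
  exact h.symm

lemma inner_coe_dIncl (q : S7) (v : TangentSpace (𝓡 7) q) :
    inner ℝ (q : EuclideanSpace ℝ (Fin 8)) (dIncl q v) = 0 := by
  rw [← Submodule.mem_orthogonal_singleton_iff_inner_right]
  have h : (dIncl q).toLinearMap.range = _ := range_mvfderiv_subtypeVal q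
  rw [← h]
  exact LinearMap.mem_range_self _ v

lemma inner_frameMap_map (i : Fin 4 ⊕ Fin 3) (v w : EuclideanSpace ℝ (Fin 8)) :
    inner ℝ (frameMap i v) (frameMap i w) = (inner ℝ v w : ℝ) := by
  have h (z) : inner ℝ (frameMap i z) (frameMap i z) = (inner ℝ z z : ℝ) := by
    rw [inner_frameMap_frameMap, if_pos rfl, real_inner_self_eq_norm_sq]
  have h1 := h (v + w)
  simp only [map_add, inner_add_left, inner_add_right, h] at h1
  have h2 := real_inner_comm (frameMap i v) (frameMap i w)
  have h3 := real_inner_comm v w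
  linarith

/-- The Riemannian divergence of a vector field on the sphere. -/
def frameDiv (X : (p : S7) → TangentSpace (𝓡 7) p) (q : S7) : ℝ :=
  ∑ j, inner ℝ (frameMap j q)
    (mvfderiv (𝓡 7) (fun p => dIncl p (X p)) q (frameField j q))

/-- Write `ν(Y) = w det a` with `a` the coordinate matrix of `Y`. The rows of coordinates of `[X,
Y_i]` are `X(a_i) - (a K)_i`, with `K` independent of `Y`. The terms in `X(a_i)` cancel the
derivative of the determinant, and the rest contributes `w * tr K * det a`. -/
lemma lieDeriv_eq (ν : TopForm (EuclideanSpace ℝ (Fin 7)) S7 (Fin 4 ⊕ Fin 3))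
    {X : (p : S7) → TangentSpace (𝓡 7) p} (hX : SmoothFieldAt X q)
    (hY : ∀ i, SmoothFieldAt (Y i) q)
    (hν : MDifferentiableAt (𝓡 7) 𝓘(ℝ, ℝ) (fun p => ν p fun i => frameField i p) q) :
    ν.lieDeriv X Y q =
      (fieldDeriv X (fun p => ν p fun i => frameField i p) q +
        frameDiv X q * ν q fun i => frameField i q) * (Matrix.of (frameMatrix Y q)).det := by
  obtain ⟨D, hD⟩ : ∃ D : ContinuousMultilinearMap ℝ (fun _ : Fin 4 ⊕ Fin 3 => Fin 4 ⊕ Fin 3 → ℝ) ℝ,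
    ∀ a, D a = (Matrix.of a).det := ⟨detRowCMM _, detRowCMM_apply⟩
  set w : S7 → ℝ := fun p => ν p fun i => frameField i p with hw
  have hmd := (contMDiffAt_frameMatrix hY).mdifferentiableAt (by simp)
  have hdet := mvfderiv_comp_fderiv (φ := frameMatrix Y) (q := q) (g := D)
    (D.hasFDerivAt (frameMatrix Y q)).differentiableAt hmd (X q)
  have hdetmd : MDifferentiableAt (𝓡 7) 𝓘(ℝ, ℝ)
      (fun p => D (frameMatrix Y p)) q :=
    (D.contDiff (n := 1)).contMDiff.mdifferentiable (by simp) _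
      |>.comp q hmd
  rw [(D.hasFDerivAt _).fderiv,
    ContinuousMultilinearMap.linearDeriv_apply] at hdet
  have h1 : fieldDeriv X (fun p => ν p fun i => Y i p) q =
      w q * ∑ i, D (Function.update (frameMatrix Y q) i
        (mvfderiv (𝓡 7) (frameMatrix Y) q (X q) i)) +
      fieldDeriv X w q * D (frameMatrix Y q) := by
    have e : (fun p => ν p fun i => Y i p) =
        w * fun p => D (frameMatrix Y p) :=
      funext fun p => by
        rw [topForm_apply_eq, Pi.mul_apply, hD]
        rfl
    have h2 := congrArg (fun L => L (X q)) (mvfderiv_mul hν hdetmd)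
    rw [fieldDeriv, e, ← hdet]
    refine h2.trans ?_
    rw [add_apply, smul_apply, smul_apply, smul_eq_mul, smul_eq_mul, mul_comm (D _)]
    rfl
  -- the defect of `[X, ·]` from being a derivation is linear
  let K : Matrix (Fin 4 ⊕ Fin 3) (Fin 4 ⊕ Fin 3) ℝ := Matrix.of fun l j =>
    inner ℝ (frameMap j (dIncl q (X q))) (frameMap l q) +
      inner ℝ (frameMap j q) (mvfderiv (𝓡 7) (fun p => dIncl p (X p)) q (frameField l q))
  have hK (i : Fin 4 ⊕ Fin 3) : (fun j => frameCoord j q (VectorField.mlieBracket (𝓡 7) X (Y i) q)) =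
      mvfderiv (𝓡 7) (frameMatrix Y) q (X q) i - (Matrix.of (frameMatrix Y q) * K) i := by
    funext j
    rw [Pi.sub_apply, mvfderiv_frameMatrix hY, frameCoord_mlieBracket hX (hY i), Matrix.mul_apply]
    congr 1
    have h2 := sum_frameCoord_smul q (Y i q)
    conv_lhs => rw [← h2]
    simp only [map_sum, map_smul, inner_sum, inner_smul_right, dIncl_frameField,
      ← Finset.sum_add_distrib, ← mul_add]
    rfl
  have htr : K.trace = frameDiv X q := by
    rw [Matrix.trace, frameDiv]
    refine Finset.sum_congr rfl fun j _ => ?_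
    -- The first summand of `K j j` is `⟨F_j X, F_j q⟩ = ⟨X, q⟩ = 0`, as `X` is tangent to the
    -- sphere.
    have h := inner_frameMap_map j (dIncl q (X q)) q
    rw [real_inner_comm _ (dIncl q (X q)), inner_coe_dIncl] at h
    simp [K, h]
  have h3 (i : Fin 4 ⊕ Fin 3) : ν q (Function.update (fun j => Y j q) i
      (VectorField.mlieBracket (𝓡 7) X (Y i) q)) =
      w q * (D (Function.update (frameMatrix Y q) i
        (mvfderiv (𝓡 7) (frameMatrix Y) q (X q) i)) -
        ((Matrix.of (frameMatrix Y q)).updateRow i ((Matrix.of (frameMatrix Y q) * K) i)).det) := by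
    rw [topForm_apply_eq]
    congr 1
    have h4 : (Matrix.of fun k j => frameCoord j q (Function.update (fun j => Y j q) i
        (VectorField.mlieBracket (𝓡 7) X (Y i) q) k)).det =
        D (Function.update (frameMatrix Y q) i
          (fun j => frameCoord j q (VectorField.mlieBracket (𝓡 7) X (Y i) q))) := by
      rw [hD]
      congr 1
      ext k j
      by_cases hk : k = i
      · subst hk
        simp
      · simp [hk, frameMatrix]
    rw [h4, hK, ContinuousMultilinearMap.map_update_sub,
      hD (Function.update (frameMatrix Y q) i ((Matrix.of (frameMatrix Y q) * K) i))]
    rfl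
  rw [TopForm.lieDeriv, h1, Finset.sum_congr rfl fun i _ => h3 i, ← Finset.mul_sum,
    Finset.sum_sub_distrib, sum_det_updateRow_mul, htr, hD]
  ring

end TopForms

/-! ### The Popp volume on the frame -/

section Popp

lemma metric_eq_sum (q : S7) (v w : S7T.horizontal q) :
    S7T.metric q v w = ∑ i, frameCoord (Sum.inl i) q v * frameCoord (Sum.inl i) q w := by
  conv_lhs => rw [← sum_smul_horizontalField q v]
  simp only [map_sum, map_smul, LinearMap.sum_apply, LinearMap.smul_apply,
    metric_horizontalField_left, smul_eq_mul]

/-- Polarization: basis vectors give the diagonal, sums of two distinct ones the other entries. -/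
lemma mul_transpose_eq_of_sum_sq {κ : Type*} [Fintype κ] [DecidableEq κ] {P : Matrix κ κ ℝ} {l : ℝ}
    (h : ∀ c : κ → ℝ, ∑ j, (∑ k, c k * P k j) ^ 2 = l * ∑ k, c k ^ 2) :
    P * P.transpose = l • 1 := by
  have hdiag (i : κ) : ∑ j, P i j ^ 2 = l := by
    have := h (Pi.single i 1)
    simpa [Pi.single_apply] using this
  ext i k
  by_cases hik : i = k
  · subst hik
    simp only [Matrix.mul_apply, Matrix.transpose_apply, ← sq, hdiag]
    simp
  · have h1 := h (Pi.single i 1 + Pi.single k 1)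
    have h2 : ∑ j, (P i j + P k j) ^ 2 =
        ∑ j, P i j ^ 2 + ∑ j, P k j ^ 2 + 2 * ∑ j, P i j * P k j := by
      rw [Finset.mul_sum, ← Finset.sum_add_distrib, ← Finset.sum_add_distrib]
      exact Finset.sum_congr rfl fun j _ => by ring
    have h3 : ∑ j, ((Pi.single i 1 + Pi.single k 1 : κ → ℝ) j) ^ 2 = 2 := by
      have (j : κ) : ((Pi.single i 1 + Pi.single k 1 : κ → ℝ) j) ^ 2 =
          (Pi.single i 1 : κ → ℝ) j + (Pi.single k 1 : κ → ℝ) j := by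
        by_cases hi : j = i <;> by_cases hk : j = k <;> simp_all
      simp only [this, Finset.sum_add_distrib, Finset.sum_pi_single', Finset.mem_univ, if_true]
      norm_num
    rw [h3] at h1
    simp only [Pi.add_apply, add_mul, Finset.sum_add_distrib] at h1
    have h4 (i j : κ) : ∑ m, (Pi.single i 1 : κ → ℝ) m * P m j = P i j := by
      simp [Pi.single_apply]
    simp only [h4, h2, hdiag] at h1
    simp only [Matrix.mul_apply, Matrix.transpose_apply, Matrix.smul_apply, Matrix.one_apply_ne hik]
    simp only [smul_zero]
    linarith

/-- The coordinate matrix of `(e, f)` is block triangular because `e` is horizontal. Its diagonal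
blocks are an orthogonal matrix and a 3 × 3 matrix `P` with `P Pᵀ = leviScale • 1`; the horizontal
part of `f` plays no role. -/
lemma det_adapted_sq {q : S7} {e : Fin 4 → S7T.horizontal q} {f : Fin 3 → TangentSpace (𝓡 7) q}
    (he : ∀ i j, S7T.metric q (e i) (e j) = if i = j then 1 else 0)
    (hf : ∀ c : Fin 3 → ℝ, S7T.IsQuotientNormSq q (leviMap q)
      (∑ i, c i • (S7T.horizontal q).mkQ (f i)) (∑ i, c i ^ 2)) :
    (Matrix.of fun i j => frameCoord j q
      (Sum.elim (fun i => (e i : TangentSpace (𝓡 7) q)) f i)).det ^ 2 = leviScale q ^ 3 := by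
  let O : Matrix (Fin 4) (Fin 4) ℝ := Matrix.of fun i j => frameCoord (Sum.inl j) q (e i)
  let P : Matrix (Fin 3) (Fin 3) ℝ := Matrix.of fun i j => frameCoord (Sum.inr j) q (f i)
  let R : Matrix (Fin 3) (Fin 4) ℝ := Matrix.of fun i j => frameCoord (Sum.inl j) q (f i)
  have hM : (Matrix.of fun i j => frameCoord j q
      (Sum.elim (fun i => (e i : TangentSpace (𝓡 7) q)) f i)) = Matrix.fromBlocks O 0 R P := by
    ext (i | i) (j | j)
    · rfl
    · exact (mem_horizontalT_iff q _).1 (e i).2 j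
    · rfl
    · rfl
  have hO : O * O.transpose = 1 := by
    ext i j
    rw [Matrix.one_apply, ← he i j, metric_eq_sum]
    rfl
  have hP : P * P.transpose = leviScale q • 1 := by
    refine mul_transpose_eq_of_sum_sq fun c => ?_
    have h1 : ∑ i, c i • (S7T.horizontal q).mkQ (f i) =
        ∑ j, (∑ k, c k * P k j) • normalClass j q := by
      simp only [mkQ_eq_sum, Finset.smul_sum, smul_smul, Finset.sum_smul]
      rw [Finset.sum_comm]
      rfl
    have h2 := hf c
    rw [h1] at h2
    have h3 := h2.unique (isQuotientNormSq_leviMap q _)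
    rw [h3]
    field_simp [(leviScale_pos q).ne']
  have hO2 := congrArg Matrix.det hO
  have hP2 := congrArg Matrix.det hP
  simp only [Matrix.det_mul, Matrix.det_transpose, Matrix.det_one, Matrix.det_smul,
    Fintype.card_fin, mul_one] at hO2 hP2
  rw [hM, Matrix.det_fromBlocks_zero₁₂, mul_pow, sq, sq, hO2, hP2, one_mul]

/-- The value of a Popp volume form on the adapted frame. -/
lemma IsPoppVolume.sq_mul {ν : TopForm (EuclideanSpace ℝ (Fin 7)) S7 (Fin 4 ⊕ Fin 3)}
    (hν : S7T.IsPoppVolume ν) (q : S7) :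
    (ν q fun i => frameField i q) ^ 2 * leviScale q ^ 3 = 1 := by
  obtain ⟨L, hL, e, f, he, hf, h⟩ := hν.2 q
  rw [IsLeviMap.eq_leviMap hL] at hf
  rw [← det_adapted_sq he hf, ← mul_pow, ← topForm_apply_eq, ← sq_abs, h, one_pow]

lemma isPoppVolume_of_sq_mul {ν : TopForm (EuclideanSpace ℝ (Fin 7)) S7 (Fin 4 ⊕ Fin 3)}
    (hs : ν.Smooth) (h : ∀ q, (ν q fun i => frameField i q) ^ 2 * leviScale q ^ 3 = 1) :
    S7T.IsPoppVolume ν := by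
  refine ⟨hs, fun q => ?_⟩
  -- Rescaling `N_k` by `√leviScale` makes its class a unit vector.
  have hf (c : Fin 3 → ℝ) : S7T.IsQuotientNormSq q (leviMap q)
      (∑ k, c k • (S7T.horizontal q).mkQ (Real.sqrt (leviScale q) • frameField (Sum.inr k) q))
      (∑ k, c k ^ 2) := by
    have h1 := isQuotientNormSq_leviMap q fun k => c k * Real.sqrt (leviScale q)
    have h2 : (∑ k, (c k * Real.sqrt (leviScale q)) ^ 2) / leviScale q = ∑ k, c k ^ 2 := by
      simp only [mul_pow, Real.sq_sqrt (leviScale_pos q).le, ← Finset.sum_mul]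
      exact mul_div_cancel_right₀ _ (leviScale_pos q).ne'
    rw [h2] at h1
    simpa only [map_smul, smul_smul, normalClass] using h1
  refine ⟨leviMap q, isLeviMap_leviMap q, fun i => horizontalField i q, _,
    metric_horizontalField q, hf, ?_⟩
  rw [← sq_eq_sq₀ (abs_nonneg _) zero_le_one, sq_abs, topForm_apply_eq, mul_pow,
    det_adapted_sq (metric_horizontalField q) hf, h, one_pow]

/-- The Popp volume form of the trivializable structure. -/
def poppForm : TopForm (EuclideanSpace ℝ (Fin 7)) S7 (Fin 4 ⊕ Fin 3) :=
  fun q => (leviScale q * Real.sqrt (leviScale q))⁻¹ • (frameBasis q).det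

lemma poppForm_frameField (q : S7) :
    poppForm q (fun i => frameField i q) = (leviScale q * Real.sqrt (leviScale q))⁻¹ := by
  have : (frameBasis q).det (fun i => frameField i q) = 1 := by
    rw [← coe_frameBasis]
    exact (frameBasis q).det_self
  simp [poppForm, this]

lemma contMDiff_leviScale : ContMDiff (𝓡 7) 𝓘(ℝ, ℝ) ∞ leviScale := by
  have h : ContDiff ℝ ∞ (fun z : EuclideanSpace ℝ (Fin 8) =>
      16 * ((∑ i : Fin 4, z (Fin.castAdd 4 i) ^ 2) ^ 2 +
        (∑ i : Fin 4, z (Fin.natAdd 4 i) ^ 2) ^ 2)) := by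
    fun_prop
  exact h.contMDiff.comp contMDiff_coe_S7

lemma isPoppVolume_poppForm : S7T.IsPoppVolume poppForm := by
  refine isPoppVolume_of_sq_mul (fun q Y hY => ?_) fun q => ?_
  · have h1 : ContMDiffAt (𝓡 7) 𝓘(ℝ, ℝ) ∞
        (fun p => (leviScale p * Real.sqrt (leviScale p))⁻¹) q := by
      have : ContDiffAt ℝ ∞ (fun x : ℝ => (x * Real.sqrt x)⁻¹) (leviScale q) :=
        (contDiffAt_id.mul (Real.contDiffAt_sqrt (leviScale_pos q).ne')).inv
          (mul_pos (leviScale_pos q) (Real.sqrt_pos.2 (leviScale_pos q))).ne'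
      exact this.contMDiffAt.comp q (contMDiff_leviScale q)
    have h2 : ContMDiffAt (𝓡 7) 𝓘(ℝ, ℝ) ∞
        (fun p => detRowCMM (Fin 4 ⊕ Fin 3) (frameMatrix Y p)) q :=
      (detRowCMM (Fin 4 ⊕ Fin 3)).contDiff.contMDiff.contMDiffAt.comp q (contMDiffAt_frameMatrix hY)
    have h3 : (fun p => poppForm p fun i => Y i p) = fun p =>
        (leviScale p * Real.sqrt (leviScale p))⁻¹ *
          detRowCMM (Fin 4 ⊕ Fin 3) (frameMatrix Y p) := by
      funext p
      rw [topForm_apply_eq, poppForm_frameField, detRowCMM_apply]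
      rfl
    rw [h3]
    exact h1.mul h2
  · rw [poppForm_frameField, inv_pow, mul_pow, Real.sq_sqrt (leviScale_pos q).le]
    have := (leviScale_pos q).ne'
    field_simp

end Popp

/-! ### Divergence in the frame and the weight function -/

section Divergence

variable {q : S7}

/-- The correction term `⟨F_j F_j q, X⟩` equals `-⟨q, X⟩ = 0`. -/
lemma frameDiv_eq {X : (p : S7) → TangentSpace (𝓡 7) p} (hX : SmoothFieldAt X q) :
    frameDiv X q = ∑ j, fieldDeriv (frameField j) (fun p => frameCoord j p (X p)) q := by
  refine Finset.sum_congr rfl fun j _ => ?_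
  rw [fieldDeriv, hX.mvfderiv_frameCoord, dIncl_frameField,
    inner_frameMap_eq_neg j (frameMap j q), inner_frameMap_map, inner_coe_dIncl, neg_zero, add_zero]

/-- Taking logarithms in `w² * leviScale³ = 1` gives `h = log |w| + (3/2) log 16`. Since `Real.log`
ignores signs, the sign of `w` is immaterial. -/
lemma fieldDeriv_weightH {w : S7 → ℝ} (hw : ∀ p, w p ^ 2 * leviScale p ^ 3 = 1)
    (hd : MDifferentiableAt (𝓡 7) 𝓘(ℝ, ℝ) w q) (X : (p : S7) → TangentSpace (𝓡 7) p) :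
    fieldDeriv X weightH q = fieldDeriv X w q / w q := by
  have hw0 (p : S7) : w p ≠ 0 := fun h => by simpa [h] using hw p
  have h1 : weightH = fun p => Real.log (w p) + 3 / 2 * Real.log 16 := by
    funext p
    have h2 := congrArg Real.log (hw p)
    have h3 := leviScale_eq p
    have hs := leviScale_pos p
    rw [Real.log_mul (pow_ne_zero _ (hw0 p)) (pow_ne_zero _ hs.ne'), Real.log_pow, Real.log_pow,
      Real.log_one] at h2
    have h4 := congrArg Real.log h3
    rw [Real.log_mul (by norm_num) (by rintro h; rw [h3, h] at hs; simp at hs)] at h4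
    rw [weightH]
    push_cast at h2
    linarith
  have hd2 : DifferentiableAt ℝ (fun x => Real.log x + 3 / 2 * Real.log 16) (w q) :=
    (Real.differentiableAt_log (hw0 q)).add_const _
  rw [fieldDeriv, h1, mvfderiv_comp_fderiv (φ := w)
    (g := fun x => Real.log x + 3 / 2 * Real.log 16) hd2 hd, fderiv_add_const,
    fderiv_eq_smul_deriv, Real.deriv_log, fieldDeriv, smul_eq_mul, div_eq_mul_inv]

end Divergence

/-! ### The horizontal gradient and its divergence -/

section Sublaplacian

variable {f : C^∞⟮𝓡 7, S7; 𝓘(ℝ, ℝ), ℝ⟯} {G : (p : S7) → S7T.horizontal p}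

lemma fieldDeriv_smooth (f : C^∞⟮𝓡 7, S7; 𝓘(ℝ, ℝ), ℝ⟯) (i : Fin 4) (q : S7) :
    ContMDiffAt (𝓡 7) 𝓘(ℝ, ℝ) ∞ (fieldDeriv (fieldX i) f) q :=
  (fieldX_smooth i q).contMDiffAt_mvfderiv f.contMDiff

lemma IsHorizontalGradient.frameCoord_inl (hG : S7T.IsHorizontalGradient f G) (i : Fin 4)
    (p : S7) : frameCoord (Sum.inl i) p (G p) = fieldDeriv (fieldX i) f p := by
  rw [← metric_horizontalField_left, S7T.metric_symm, hG]
  rfl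

lemma IsHorizontalGradient.eq_sum (hG : S7T.IsHorizontalGradient f G) (p : S7) :
    (G p : TangentSpace (𝓡 7) p) = ∑ i, fieldDeriv (fieldX i) f p • fieldX i p := by
  have h := congrArg Subtype.val (sum_smul_horizontalField p (G p))
  rw [← h, AddSubmonoidClass.coe_finsetSum]
  refine Finset.sum_congr rfl fun i _ => ?_
  rw [IsHorizontalGradient.frameCoord_inl hG]
  rfl

/-- Smoothness is not part of the definition of a gradient; it follows from the expansion `∑ (X_i f)
X_i`. -/
lemma IsHorizontalGradient.smooth (hG : S7T.IsHorizontalGradient f G) (q : S7) :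
    SmoothFieldAt (fun p => (G p : TangentSpace (𝓡 7) p)) q := by
  have h : (fun p => (G p : TangentSpace (𝓡 7) p)) =
      fun p => ∑ i, fieldDeriv (fieldX i) f p • fieldX i p :=
    funext fun p => IsHorizontalGradient.eq_sum hG p
  rw [h]
  exact ContMDiffAt.sum_section fun i _ =>
    (fieldDeriv_smooth f i q).smul_section (fieldX_smooth i q)

lemma IsHorizontalGradient.fieldDeriv_eq (hG : S7T.IsHorizontalGradient f G) (φ : S7 → ℝ)
    (q : S7) : fieldDeriv (fun p => (G p : TangentSpace (𝓡 7) p)) φ q =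
      ∑ i, fieldDeriv (fieldX i) φ q * fieldDeriv (fieldX i) f q := by
  rw [fieldDeriv, IsHorizontalGradient.eq_sum hG, map_sum]
  refine Finset.sum_congr rfl fun i _ => ?_
  rw [map_smul, smul_eq_mul, mul_comm]
  rfl

lemma IsHorizontalGradient.frameDiv_eq (hG : S7T.IsHorizontalGradient f G) (q : S7) :
    frameDiv (fun p => (G p : TangentSpace (𝓡 7) p)) q =
      ∑ i, fieldDeriv (fieldX i) (fieldDeriv (fieldX i) f) q := by
  rw [SubRiemannian.frameDiv_eq (IsHorizontalGradient.smooth hG q), Fintype.sum_sum_type]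
  have h0 (k : Fin 3) : (fun p => frameCoord (Sum.inr k) p (G p)) = fun _ => 0 :=
    funext fun p => (mem_horizontalT_iff p _).1 (G p).2 k
  have h1 (i : Fin 4) : (fun p => frameCoord (Sum.inl i) p (G p)) = fieldDeriv (fieldX i) f :=
    funext fun p => IsHorizontalGradient.frameCoord_inl hG i p
  simp only [h0, h1, fieldDeriv, mvfderiv_const, zero_apply, Finset.sum_const_zero, add_zero]
  rfl

lemma isHorizontalGradient_sum (f : C^∞⟮𝓡 7, S7; 𝓘(ℝ, ℝ), ℝ⟯) :
    S7T.IsHorizontalGradient f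
      fun p => ∑ i, fieldDeriv (fieldX i) f p • horizontalField i p := by
  intro q v
  have h := congrArg Subtype.val (sum_smul_horizontalField q v)
  rw [← h, AddSubmonoidClass.coe_finsetSum, map_sum]
  simp only [map_sum, map_smul, LinearMap.sum_apply, LinearMap.smul_apply,
    metric_horizontalField_left, smul_eq_mul]
  refine Finset.sum_congr rfl fun i _ => ?_
  rw [mul_comm]
  exact ((mvfderiv (𝓡 7) f q).map_smul _ _).symm

/-- Holding for any Popp form and any gradient, this settles both existence and uniqueness. The
divergence is determined by testing on the frame, where `ν` does not vanish. -/
lemma isDivergence_iff {ν : TopForm (EuclideanSpace ℝ (Fin 7)) S7 (Fin 4 ⊕ Fin 3)}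
    (hν : S7T.IsPoppVolume ν) (hG : S7T.IsHorizontalGradient f G) (d : S7 → ℝ) :
    ν.IsDivergence (fun p => (G p : TangentSpace (𝓡 7) p)) d ↔
      ∀ q, d q = ∑ i : Fin 4, (fieldDeriv (fieldX i) (fieldDeriv (fieldX i) f) q +
        fieldDeriv (fieldX i) weightH q * fieldDeriv (fieldX i) f q) := by
  have hd (q : S7) : MDifferentiableAt (𝓡 7) 𝓘(ℝ, ℝ) (fun p => ν p fun i => frameField i p) q :=
    (hν.1 q frameField fun i => frameField_smooth i q).mdifferentiableAt (by simp)
  have hsq := IsPoppVolume.sq_mul hν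
  have hw0 (p : S7) : (ν p fun i => frameField i p) ≠ 0 := fun h => by simpa [h] using hsq p
  have key (q : S7) (Y : Fin 4 ⊕ Fin 3 → (p : S7) → TangentSpace (𝓡 7) p)
      (hY : ∀ i, SmoothFieldAt (Y i) q) :
      ν.lieDeriv (fun p => (G p : TangentSpace (𝓡 7) p)) Y q =
        (∑ i : Fin 4, (fieldDeriv (fieldX i) (fieldDeriv (fieldX i) f) q +
          fieldDeriv (fieldX i) weightH q * fieldDeriv (fieldX i) f q)) *
        ν q (fun i => Y i q) := by
    have h1 := fieldDeriv_weightH hsq (hd q) fun p => (G p : TangentSpace (𝓡 7) p)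
    rw [eq_div_iff (hw0 q)] at h1
    rw [lieDeriv_eq ν (IsHorizontalGradient.smooth hG q) hY (hd q), ← h1, ← add_mul,
      IsHorizontalGradient.fieldDeriv_eq hG, IsHorizontalGradient.frameDiv_eq hG,
      Finset.sum_add_distrib, topForm_apply_eq q (ν q) fun i => Y i q, mul_assoc, add_comm]
    rfl
  constructor
  · intro h q
    have h1 := h q frameField fun i => frameField_smooth i q
    rw [key q frameField fun i => frameField_smooth i q] at h1
    exact (mul_right_cancel₀ (hw0 q) h1).symm
  · intro h q Y hY
    rw [key q Y hY, h q]

end Sublaplacian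

end SubRiemannian

end

theorem mainTheorem10 (f : C^∞⟮𝓡 7, SubRiemannian.S7; 𝓘(ℝ, ℝ), ℝ⟯)
    (u : SubRiemannian.S7 → ℝ) :
    SubRiemannian.S7T.IsIntrinsicSublaplacian f u ↔
      ∀ z : SubRiemannian.S7, u z = -∑ i : Fin 4,
        (SubRiemannian.fieldDeriv (SubRiemannian.fieldX i)
            (SubRiemannian.fieldDeriv (SubRiemannian.fieldX i) f) z +
          SubRiemannian.fieldDeriv (SubRiemannian.fieldX i) SubRiemannian.weightH z *
            SubRiemannian.fieldDeriv (SubRiemannian.fieldX i) f z) := by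
  constructor
  · rintro ⟨ν, G, hν, hG, h⟩ z
    rw [← (SubRiemannian.isDivergence_iff hν hG _).1 h z, neg_neg]
  · intro h
    refine ⟨_, _, SubRiemannian.isPoppVolume_poppForm, SubRiemannian.isHorizontalGradient_sum f,
      (SubRiemannian.isDivergence_iff SubRiemannian.isPoppVolume_poppForm
        (SubRiemannian.isHorizontalGradient_sum f) _).2 fun z => ?_⟩
    rw [h z, neg_neg]
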